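/- **Definitions.** A \emph{globular set} is a sequence of sets $X_i$ ($i\ge 0$) with maps $dom_i^{i+1},cod_i^{i+1}:X_{i+1}\to X_i$ such that $dom\circ dom=dom\circ cod$ and $cod\circ dom=cod\circ cod$; for $i<j$ write $dom_i^j,cod_i^j:X_j\to X_i$ for the iterated maps. An \emph{omega graph} is a globular set with maps $id^i_{i+1}:X_i\to X_{i+1}$ (iterates $id^i_j$) such that $dom(id\,x)=x=cod(id\,x)$. An \emph{omega magma} is an omega graph with, for all $0\le i<j$, a partial binary operation $\bigcirc_i^j$ on $X_j$ (given by its graph) such that $a\bigcirc_i^j b$ is defined if and only if $cod_i^j a=dom_i^j b$; if $j=i+1$, then $dom_i^j(a\bigcirc_i^j b)=dom_i^j a$ and $cod_i^j(a\bigcirc_i^j b)=cod_i^j b$; if $j>i+1$, then $dom_{j-1}^j$ and $cod_{j-1}^j$ carry $a\bigcirc_i^j b$ to the $\bigcirc_i^{j-1}$-composite of the images of $a$ and $b$. Morphisms of omega graphs and of omega magmas are dimensionwise maps preserving all the structure. An omega magma is a \emph{strict omega category} if, whenever both sides are defined, $(a\bigcirc_i^j b)\bigcirc_i^j c=a\bigcirc_i^j(b\bigcirc_i^j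 c)$ and, for $i<j<k$, $(a\bigcirc_j^k b)\bigcirc_i^k(c\bigcirc_j^k d)=(a\bigcirc_i^k c)\bigcirc_j^k(b\bigcirc_i^k d)$, and moreover $id^i_j(dom_i^j a)\bigcirc_i^j a=a=a\bigcirc_i^j id^i_j(cod_i^j a)$ and, whenever $a\bigcirc_i^j b$ is defined, $id^j_{j+1}(a)\bigcirc_i^{j+1}id^j_{j+1}(b)=id^j_{j+1}(a\bigcirc_i^j b)$. Cells $a,b\in X_i$ are \emph{parallel} if $i=0$, or if they have the same domain and the same codomain in $X_{i-1}$. A \emph{bridge relation} on an omega graph $X$ is a sequence of relations $R_i\subseteq X_i\times X_i\times X_{i+1}$ such that: $(a,b,c)\in R_i$ implies that $a,b$ are parallel, $dom\,c=a$ and $cod\,c=b$; $(a,a,id\,a)\in R_i$ for all $a\in X_i$; and $(a,b,c),(a,b,d)\in R_i$ implies $c=d$. The \emph{diagonal} bridge relation $R^\Delta$ consists of the triples $(a,a,id\,a)$. A \emph{bridge morphism} is a morphism of omega magmas that preserves given bridge relations. A \emph{categorical Penon morphism} $F:(X,R)\to(Y,R^\Delta)$ is a bridge morphism such that $Y$ is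 a strict omega category; $(a,b,c)\in R_i$ implies $Fa=Fb$ and $Fc=id(Fa)$; and if $a,b\in X_i$ are parallel with $Fa=Fb$, then $(a,b,c)\in R_i$ for some $c$. A \emph{weak omega category} $\mathbf X$ consists of omega magmas $X_1,X_2$, a strict omega category $X_3$, a morphism of omega magmas $\lambda:X_2\to X_1$, a morphism of omega graphs $\rho:X_1\to X_2$ with $\lambda\circ\rho=1$, a bridge relation $R$ on $X_2$, and a categorical Penon morphism $\kappa:(X_2,R)\to(X_3,R^\Delta)$. An \emph{omega functor} $\mathbf X\to\mathbf Y$ is a triple of omega magma morphisms $F_i:X_i\to Y_i$ ($i=1,2,3$) such that $F_2$ is a bridge morphism, $F_1\lambda^X=\lambda^YF_2$, $F_3\kappa^X=\kappa^YF_2$ and $F_2\rho^X=\rho^YF_1$. A \emph{finitary essentially algebraic theory} consists of a set of sorts; a set of sorted operation symbols of finite arity, some of them declared total; for each of the other symbols, a finite set of equations between terms built from total operation symbols in the argument variables of that symbol; and a set of equations between terms, each in finitely many variables. A \emph{model} assigns a small set to each sort and a partial operation to each operation symbol, so that total symbols are everywhere defined, every other symbol is defined exactly on those tuples that satisfy its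 defining equations, and each equation of the theory holds whenever both of its sides are defined. A morphism of models is a family of maps, one for each sort, that commutes with all the operations. **Theorem 16.** The category $\mathit{Omega\_Cat}$ of small weak omega categories and omega functors is (isomorphic to) the category of models of a finitary essentially algebraic theory. It is locally finitely presentable, and in particular it is complete and cocomplete. -/

import Mathlib

open CategoryTheory

universe u

/-! ### Globular sets, omega graphs, omega magmas, strict omega categories -/

/-- A (small) globular set. `dom i` and `cod i` are the functions `dom^{i+1}_i`, `cod^{i+1}_i`. -/
structure GlobularSet : Type (u + 1) where
  cell : ℕ → Type u
  dom : ∀ i, cell (i + 1) → cell i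
  cod : ∀ i, cell (i + 1) → cell i
  dom_dom : ∀ i (x : cell (i + 2)), dom i (dom (i + 1) x) = dom i (cod (i + 1) x)
  cod_dom : ∀ i (x : cell (i + 2)), cod i (dom (i + 1) x) = cod i (cod (i + 1) x)

namespace GlobularSet

/-- The iterated domain `dom^j_i : X_j → X_i`, for `i ≤ j` (the identity for `i = j`). -/
def domTo (X : GlobularSet.{u}) {i j : ℕ} (h : i ≤ j) : X.cell j → X.cell i :=
  Nat.leRec (motive := fun j _ => X.cell j → X.cell i) (fun x => x)
    (fun {k} _ f x => f (X.dom k x)) h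

/-- The iterated codomain `cod^j_i : X_j → X_i`, for `i ≤ j` (the identity for `i = j`). -/
def codTo (X : GlobularSet.{u}) {i j : ℕ} (h : i ≤ j) : X.cell j → X.cell i :=
  Nat.leRec (motive := fun j _ => X.cell j → X.cell i) (fun x => x)
    (fun {k} _ f x => f (X.cod k x)) h

/-- Two cells of the same dimension are parallel if they have the same domain and the same
codomain; any two `0`-cells are parallel. -/
def Parallel (X : GlobularSet.{u}) : ∀ {i : ℕ}, X.cell i → X.cell i → Prop
  | 0, _, _ => True
  | i + 1, a, b => X.dom i a = X.dom i b ∧ X.cod i a = X.cod i b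

end GlobularSet

/-- A (small) omega graph: a globular set with identity functions `idn i = id^i_{i+1}`. -/
structure OmegaGraph : Type (u + 1) extends GlobularSet.{u} where
  idn : ∀ i, cell i → cell (i + 1)
  dom_idn : ∀ i (x : cell i), dom i (idn i x) = x
  cod_idn : ∀ i (x : cell i), cod i (idn i x) = x

namespace OmegaGraph

/-- The iterated identity `id^i_j : X_i → X_j`, for `i ≤ j` (the identity map for `i = j`). -/
def idTo (X : OmegaGraph.{u}) {i j : ℕ} (h : i ≤ j) : X.cell i → X.cell j :=
  Nat.leRec (motive := fun j _ => X.cell i → X.cell j) (fun x => x)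
    (fun {k} _ f x => X.idn k (f x)) h

/-- Morphisms of omega graphs. -/
@[ext]
structure Hom (X Y : OmegaGraph.{u}) : Type u where
  app : ∀ i, X.cell i → Y.cell i
  app_dom : ∀ i (x : X.cell (i + 1)), app i (X.dom i x) = Y.dom i (app (i + 1) x)
  app_cod : ∀ i (x : X.cell (i + 1)), app i (X.cod i x) = Y.cod i (app (i + 1) x)
  app_idn : ∀ i (x : X.cell i), app (i + 1) (X.idn i x) = Y.idn i (app i x)

/-- The category of omega graphs. -/
instance : Category.{u} OmegaGraph.{u} where
  Hom := Hom
  id X :=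
    { app := fun _ x => x
      app_dom := fun _ _ => rfl
      app_cod := fun _ _ => rfl
      app_idn := fun _ _ => rfl }
  comp F G :=
    { app := fun i x => G.app i (F.app i x)
      app_dom := fun i x => by rw [F.app_dom, G.app_dom]
      app_cod := fun i x => by rw [F.app_cod, G.app_cod]
      app_idn := fun i x => by rw [F.app_idn, G.app_idn] }

end OmegaGraph

/-- A (small) omega magma: an omega graph with composition relations
`comp i j _ = Comp^j_i ⊆ X_j × X_j × X_j` for `i < j`. -/
structure OmegaMagma : Type (u + 1) extends OmegaGraph.{u} where
  comp : ∀ i j : ℕ, i < j → cell j → cell j → cell j → Prop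
  composable : ∀ (i j : ℕ) (h : i < j) (a b c : cell j), comp i j h a b c →
    toGlobularSet.codTo h.le a = toGlobularSet.domTo h.le b
  comp_unique : ∀ (i j : ℕ) (h : i < j) (a b c d : cell j),
    comp i j h a b c → comp i j h a b d → c = d
  comp_exists : ∀ (i j : ℕ) (h : i < j) (a b : cell j),
    toGlobularSet.codTo h.le a = toGlobularSet.domTo h.le b → ∃ c, comp i j h a b c
  comp_dom_cod : ∀ (i : ℕ) (a b c : cell (i + 1)), comp i (i + 1) i.lt_succ_self a b c →
    dom i c = dom i a ∧ cod i c = cod i b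
  comp_lower : ∀ (i j : ℕ) (h : i < j) (a b c : cell (j + 1)),
    comp i (j + 1) (h.trans j.lt_succ_self) a b c →
      comp i j h (dom j a) (dom j b) (dom j c) ∧ comp i j h (cod j a) (cod j b) (cod j c)

namespace OmegaMagma

/-- Morphisms of omega magmas. -/
@[ext]
structure Hom (X Y : OmegaMagma.{u}) : Type u
    extends OmegaGraph.Hom X.toOmegaGraph Y.toOmegaGraph where
  app_comp : ∀ (i j : ℕ) (h : i < j) (a b c : X.cell j), X.comp i j h a b c →
    Y.comp i j h (app j a) (app j b) (app j c)

/-- The category of omega magmas. -/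
instance : Category.{u} OmegaMagma.{u} where
  Hom := Hom
  id X := { toHom := 𝟙 X.toOmegaGraph, app_comp := fun _ _ _ _ _ _ h => h }
  comp {X Y Z} F G :=
    { toHom := (show X.toOmegaGraph ⟶ Y.toOmegaGraph from F.toHom) ≫
        (show Y.toOmegaGraph ⟶ Z.toOmegaGraph from G.toHom)
      app_comp := fun i j h a b c hc => G.app_comp i j h _ _ _ (F.app_comp i j h a b c hc) }

/-- The forgetful functor from omega magmas to omega graphs. -/
def forgetToGraph : OmegaMagma.{u} ⥤ OmegaGraph.{u} where
  obj X := X.toOmegaGraph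
  map F := F.toHom

/-- An omega magma is a strict omega category if its composition laws satisfy the
associativity, interchange, identity and identity interchange laws. As usual for partial
operations, the first two are imposed whenever all the composites in them exist. -/
structure IsStrict (X : OmegaMagma.{u}) : Prop where
  assoc : ∀ (i j : ℕ) (h : i < j) (a b c ab bc l r : X.cell j),
    X.comp i j h a b ab → X.comp i j h ab c l →
    X.comp i j h b c bc → X.comp i j h a bc r → l = r
  interchange : ∀ (i j k : ℕ) (h : i < j) (h' : j < k) (a b c d ab cd ac bd l r : X.cell k),
    X.comp j k h' a b ab → X.comp j k h' c d cd → X.comp i k (h.trans h') ab cd l →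
    X.comp i k (h.trans h') a c ac → X.comp i k (h.trans h') b d bd → X.comp j k h' ac bd r →
    l = r
  id_comp : ∀ (i j : ℕ) (h : i < j) (a : X.cell j),
    X.comp i j h (X.idTo h.le (X.domTo h.le a)) a a
  comp_id : ∀ (i j : ℕ) (h : i < j) (a : X.cell j),
    X.comp i j h a (X.idTo h.le (X.codTo h.le a)) a
  id_interchange : ∀ (i j : ℕ) (h : i < j) (a b c : X.cell j), X.comp i j h a b c →
    X.comp i (j + 1) (h.trans j.lt_succ_self) (X.idn j a) (X.idn j b) (X.idn j c)

end OmegaMagma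

/-! ### Bridge relations and categorical Penon morphisms -/

/-- A bridge relation on an omega graph. -/
structure BridgeRelation (X : OmegaGraph.{u}) : Type u where
  rel : ∀ i, X.cell i → X.cell i → X.cell (i + 1) → Prop
  parallel : ∀ i a b c, rel i a b c → X.Parallel a b ∧ X.dom i c = a ∧ X.cod i c = b
  refl : ∀ i a, rel i a a (X.idn i a)
  unique : ∀ i a b c d, rel i a b c → rel i a b d → c = d

/-- The diagonal bridge relation, consisting of the triples `(a, a, id a)`. -/
def BridgeRelation.diagonal (X : OmegaGraph.{u}) : BridgeRelation X where
  rel i a b c := a = b ∧ c = X.idn i a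
  parallel := by
    rintro i a b c ⟨rfl, rfl⟩
    refine ⟨?_, X.dom_idn i a, X.cod_idn i a⟩
    cases i
    · trivial
    · exact ⟨rfl, rfl⟩
  refl _ _ := ⟨rfl, rfl⟩
  unique := by
    rintro i a b c d ⟨-, rfl⟩ ⟨-, rfl⟩
    rfl

/-- A morphism of omega magmas is a bridge morphism if it preserves the bridge relations. -/
def IsBridgeMorphism {X Y : OmegaMagma.{u}} (R : BridgeRelation X.toOmegaGraph)
    (S : BridgeRelation Y.toOmegaGraph) (F : X ⟶ Y) : Prop :=
  ∀ i a b c, R.rel i a b c → S.rel i (F.app i a) (F.app i b) (F.app (i + 1) c)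

/-- Categorical Penon morphisms `F : (X, R) ⟶ (Y, S)`. -/
structure IsCategoricalPenon {X Y : OmegaMagma.{u}} (R : BridgeRelation X.toOmegaGraph)
    (S : BridgeRelation Y.toOmegaGraph) (F : X ⟶ Y) : Prop where
  isBridgeMorphism : IsBridgeMorphism R S F
  isStrict : Y.IsStrict
  eq_diagonal : S = BridgeRelation.diagonal Y.toOmegaGraph
  map_rel : ∀ i a b c, R.rel i a b c →
    F.app i a = F.app i b ∧ F.app (i + 1) c = Y.idn i (F.app i a)
  exists_rel : ∀ i (a b : X.cell i), X.Parallel a b → F.app i a = F.app i b →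
    ∃ c, R.rel i a b c

/-! ### Weak omega categories and omega functors -/

/-- A (small) weak omega category. -/
structure WeakOmegaCat : Type (u + 1) where
  /-- the underlying magma -/
  X₁ : OmegaMagma.{u}
  /-- the coherence magma -/
  X₂ : OmegaMagma.{u}
  /-- the coherence morphism -/
  lam : X₂ ⟶ X₁
  /-- a splitting of the coherence morphism, as a morphism of omega graphs only -/
  rho : OmegaMagma.forgetToGraph.obj X₁ ⟶ OmegaMagma.forgetToGraph.obj X₂
  split : rho ≫ OmegaMagma.forgetToGraph.map lam = 𝟙 _
  R : BridgeRelation X₂.toOmegaGraph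
  X₃ : OmegaMagma.{u}
  isStrict : X₃.IsStrict
  kappa : X₂ ⟶ X₃
  isPenon : IsCategoricalPenon R (BridgeRelation.diagonal X₃.toOmegaGraph) kappa

namespace WeakOmegaCat

/-- Omega functors. -/
@[ext]
structure Hom (X Y : WeakOmegaCat.{u}) : Type u where
  F₁ : X.X₁ ⟶ Y.X₁
  F₂ : X.X₂ ⟶ Y.X₂
  F₃ : X.X₃ ⟶ Y.X₃
  isBridgeMorphism : IsBridgeMorphism X.R Y.R F₂
  lam_comm : X.lam ≫ F₁ = F₂ ≫ Y.lam
  kappa_comm : X.kappa ≫ F₃ = F₂ ≫ Y.kappa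
  rho_comm : X.rho ≫ OmegaMagma.forgetToGraph.map F₂ =
    OmegaMagma.forgetToGraph.map F₁ ≫ Y.rho

/-- The category of weak omega categories and omega functors. -/
instance : Category.{u} WeakOmegaCat.{u} where
  Hom := Hom
  id X :=
    { F₁ := 𝟙 _
      F₂ := 𝟙 _
      F₃ := 𝟙 _
      isBridgeMorphism := fun _ _ _ _ h => h
      lam_comm := by simp
      kappa_comm := by simp
      rho_comm := by simp }
  comp F G :=
    { F₁ := F.F₁ ≫ G.F₁
      F₂ := F.F₂ ≫ G.F₂
      F₃ := F.F₃ ≫ G.F₃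
      isBridgeMorphism := fun i a b c h =>
        G.isBridgeMorphism i _ _ _ (F.isBridgeMorphism i a b c h)
      lam_comm := by rw [← Category.assoc, F.lam_comm, Category.assoc, G.lam_comm, Category.assoc]
      kappa_comm := by
        rw [← Category.assoc, F.kappa_comm, Category.assoc, G.kappa_comm, Category.assoc]
      rho_comm := by
        rw [Functor.map_comp, ← Category.assoc, F.rho_comm, Category.assoc, G.rho_comm,
          Functor.map_comp, Category.assoc] }
  id_comp F := Hom.ext (Category.id_comp F.F₁) (Category.id_comp F.F₂) (Category.id_comp F.F₃)
  comp_id F := Hom.ext (Category.comp_id F.F₁) (Category.comp_id F.F₂) (Category.comp_id F.F₃)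
  assoc F G H := Hom.ext (Category.assoc F.F₁ G.F₁ H.F₁) (Category.assoc F.F₂ G.F₂ H.F₂)
    (Category.assoc F.F₃ G.F₃ H.F₃)

end WeakOmegaCat

/-- The category of small weak omega categories and omega functors. -/
abbrev OmegaCat : Type (u + 1) := WeakOmegaCat.{u}

/-! ### Finitary essentially algebraic theories and their models -/

/-- A many-sorted signature with finitary operation symbols. -/
structure FinSignature where
  Sorts : Type
  Op : Type
  arity : Op → ℕ
  dom : ∀ f : Op, Fin (arity f) → Sorts
  cod : Op → Sorts

/-- Terms, by their sort, over the signature `S` in finitely many sorted variables `Γ`. -/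
inductive FinSignature.Term (S : FinSignature) {n : ℕ} (Γ : Fin n → S.Sorts) : S.Sorts → Type
  | var (i : Fin n) : FinSignature.Term S Γ (Γ i)
  | app (f : S.Op) (t : ∀ k : Fin (S.arity f), FinSignature.Term S Γ (S.dom f k)) :
      FinSignature.Term S Γ (S.cod f)

/-- The term involves only operation symbols in the set `T`. -/
def FinSignature.Term.UsesOnly {S : FinSignature} {n : ℕ} {Γ : Fin n → S.Sorts}
    (T : Set S.Op) : ∀ {s : S.Sorts}, S.Term Γ s → Prop
  | _, .var _ => True
  | _, .app f t => f ∈ T ∧ ∀ k, (t k).UsesOnly T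

/-- An equation between two terms of the same sort, in the variables `Γ`. -/
structure FinSignature.Equation (S : FinSignature) {n : ℕ} (Γ : Fin n → S.Sorts) where
  sort : S.Sorts
  lhs : S.Term Γ sort
  rhs : S.Term Γ sort

/-- A finitary essentially algebraic theory: a set of sorts, a set of finitary operation
symbols, some of which are declared total, for each of the other (partial) ones a finite list of
equations between terms in the total operations which describes its domain of definition, and a
set of equations, each in finitely many variables. -/
structure EssAlgTheory extends FinSignature where
  total : Set Op
  defEqns : ∀ f : Op, f ∉ total → List (toFinSignature.Equation (dom f))
  defEqns_total : ∀ (f : Op) (hf : f ∉ total), ∀ e ∈ defEqns f hf,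
    e.lhs.UsesOnly total ∧ e.rhs.UsesOnly total
  eqns : Set (Σ (n : ℕ) (Γ : Fin n → Sorts), toFinSignature.Equation Γ)

/-- A partial algebra for a signature. -/
structure PartialAlgebra (S : FinSignature) : Type (u + 1) where
  carrier : S.Sorts → Type u
  op : ∀ f : S.Op, (∀ k, carrier (S.dom f k)) → Part (carrier (S.cod f))

/-- `A.Denotes v t a`: under the assignment `v` of the variables the term `t` is defined in the
partial algebra `A`, with value `a`. -/
def PartialAlgebra.Denotes {S : FinSignature} (A : PartialAlgebra.{u} S) {n : ℕ}
    {Γ : Fin n → S.Sorts} (v : ∀ i, A.carrier (Γ i)) :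
    ∀ {s : S.Sorts}, S.Term Γ s → A.carrier s → Prop
  | _, .var i, a => v i = a
  | _, .app f t, a => ∃ b : ∀ k, A.carrier (S.dom f k),
      (∀ k, A.Denotes v (t k) (b k)) ∧ a ∈ A.op f b

namespace EssAlgTheory

/-- A model of an essentially algebraic theory: a partial algebra in which the total operations
are everywhere defined, a partial operation is defined exactly on the tuples at which its defining
equations hold, and each equation of the theory holds whenever both sides are defined. -/
structure Model (T : EssAlgTheory) : Type (u + 1)
    extends PartialAlgebra.{u} T.toFinSignature where
  op_total : ∀ f ∈ T.total, ∀ x, (op f x).Dom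
  op_dom_iff : ∀ (f : T.Op) (hf : f ∉ T.total) (x : ∀ k, carrier (T.dom f k)),
    (op f x).Dom ↔ ∀ e ∈ T.defEqns f hf,
      ∃ a, toPartialAlgebra.Denotes x e.lhs a ∧ toPartialAlgebra.Denotes x e.rhs a
  holds : ∀ e ∈ T.eqns, ∀ (v : ∀ i, carrier (e.2.1 i)) (a b : carrier e.2.2.sort),
    toPartialAlgebra.Denotes v e.2.2.lhs a → toPartialAlgebra.Denotes v e.2.2.rhs b → a = b

/-- Morphisms of models: families of maps which commute with all operations. -/
@[ext]
structure Model.Hom {T : EssAlgTheory} (M N : Model.{u} T) : Type u where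
  app : ∀ s, M.carrier s → N.carrier s
  app_op : ∀ (f : T.Op) (x : ∀ k, M.carrier (T.dom f k)) (a : M.carrier (T.cod f)),
    a ∈ M.op f x → app _ a ∈ N.op f (fun k => app _ (x k))

/-- The category of (small) models of an essentially algebraic theory. -/
instance (T : EssAlgTheory) : Category.{u} (Model.{u} T) where
  Hom := Model.Hom
  id M := { app := fun _ x => x, app_op := fun _ _ _ h => h }
  comp F G :=
    { app := fun s x => G.app s (F.app s x)
      app_op := fun f _ _ h => G.app_op f _ _ (F.app_op f _ _ h) }

end EssAlgTheory

/-- A functor is an isomorphism of categories: it has an inverse functor. -/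
def IsCatIso {C D : Type (u + 1)} [Category.{u} C] [Category.{u} D] (F : C ⥤ D) : Prop :=
  ∃ G : D ⥤ C, F ⋙ G = 𝟭 C ∧ G ⋙ F = 𝟭 D

/-! A weak omega category is a family of sets, indexed by one of three magmas and a dimension, with
operations. Boundaries, identities, `lam`, `rho` and `kappa` are total. A composite is defined
exactly when an equation between iterated boundaries holds. Bridges look less algebraic, but by
uniqueness a bridge is a function of its two ends, and the Penon condition says that it exists
exactly for parallel cells with the same image under `kappa`: this is a partial operation whose
domain is cut out by equations in total operations. All other laws are equations, and together they
form `OmegaTheory.theory`.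

An equation binds only where both sides are defined, so a unit or boundary axiom asserts no
existence. Existence comes from the defining equations: globularity shows that the required
composite is defined, and the axiom then identifies it. `OmegaTheory.Raw` stores the operations of a
model and of a weak omega category alike, so that each axiom is translated only once. Omega functors
are exactly the families of maps preserving the graphs of the operations, so `toModel` is full and
faithful; carriers are never changed, so it is bijective on objects, and it is an isomorphism by
`IsCatIso.of_bijective`.

Everything else holds for any finitary essentially algebraic theory. Limits are computed sortwise. A
submodel generated by a family of elements can be carried by a set of terms, so up to isomorphism
there is only a set of them; this is the solution set in the adjoint functor theorem, which yields
free models and colimits. Filtered colimits are computed sortwise, since terms and lists of defining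
equations are finite. Hence the free models on one generator are finitely presentable, and they form
a strong generator because bijective morphisms are invertible. -/

/-! ### Partial algebras given by the graphs of their operations -/

namespace PartialAlgebra

variable {S : FinSignature}

/-- The partial algebra whose operations have the given (functional) relations as graphs. -/
noncomputable def ofGraph (C : S.Sorts → Type u)
    (g : ∀ f : S.Op, (∀ k, C (S.dom f k)) → C (S.cod f) → Prop) : PartialAlgebra.{u} S where
  carrier := C
  op f x := ⟨∃ a, g f x a, fun h => h.choose⟩

/-- The value is picked by choice, so it recovers the graph only because the graph is functional. -/
theorem mem_op_ofGraph {C : S.Sorts → Type u}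
    {g : ∀ f : S.Op, (∀ k, C (S.dom f k)) → C (S.cod f) → Prop}
    (hg : ∀ f x a b, g f x a → g f x b → a = b) {f : S.Op} {x : ∀ k, C (S.dom f k)}
    {a : C (S.cod f)} : a ∈ (ofGraph C g).op f x ↔ g f x a := by
  constructor
  · rintro ⟨h, rfl⟩
    exact Exists.choose_spec h
  · intro h
    have h' : ∃ a, g f x a := ⟨a, h⟩
    exact ⟨h', hg f x _ _ h'.choose_spec h⟩

/-- The value of a term is unique. -/
theorem Denotes.unique (A : PartialAlgebra.{u} S) {n : ℕ} {Γ : Fin n → S.Sorts}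
    {v : ∀ i, A.carrier (Γ i)} : ∀ {s : S.Sorts} (t : S.Term Γ s) {a b : A.carrier s},
    A.Denotes v t a → A.Denotes v t b → a = b
  | _, .var i, _, _, ha, hb => ha.symm.trans hb
  | _, .app f t, _, _, ⟨x, hx, ha⟩, ⟨y, hy, hb⟩ => by
    obtain rfl : x = y := funext fun k => Denotes.unique A (t k) (hx k) (hy k)
    exact Part.mem_unique ha hb

/-- Families of maps preserving the operations preserve the values of terms. -/
theorem Denotes.map {A B : PartialAlgebra.{u} S} (φ : ∀ s, A.carrier s → B.carrier s)
    (hφ : ∀ f x a, a ∈ A.op f x → φ _ a ∈ B.op f (fun k => φ _ (x k)))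
    {n : ℕ} {Γ : Fin n → S.Sorts} {v : ∀ i, A.carrier (Γ i)} :
    ∀ {s : S.Sorts} (t : S.Term Γ s) {a : A.carrier s},
    A.Denotes v t a → B.Denotes (fun i => φ _ (v i)) t (φ _ a)
  | _, .var i, _, ha => congrArg (φ _) ha
  | _, .app f t, _, ⟨x, hx, ha⟩ =>
    ⟨fun k => φ _ (x k), fun k => Denotes.map φ hφ (t k) (hx k), hφ f x _ ha⟩

end PartialAlgebra

/-! ### Definedness, and models given by graphs -/

namespace EssAlgTheory

variable {T : EssAlgTheory}

/-- The defining condition of the operation symbol `f` holds at the tuple `x`. -/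
def Defined (A : PartialAlgebra.{u} T.toFinSignature) (f : T.Op)
    (x : ∀ k, A.carrier (T.dom f k)) : Prop :=
  ∀ hf : f ∉ T.total, ∀ e ∈ T.defEqns f hf, ∃ a, A.Denotes x e.lhs a ∧ A.Denotes x e.rhs a

/-- In total operations of an algebra, every term has a value. -/
theorem exists_denotes (A : PartialAlgebra.{u} T.toFinSignature)
    (hA : ∀ f ∈ T.total, ∀ x, (A.op f x).Dom) {n : ℕ} {Γ : Fin n → T.Sorts}
    (v : ∀ i, A.carrier (Γ i)) : ∀ {s : T.Sorts} (t : T.Term Γ s), t.UsesOnly T.total →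
    ∃ a, A.Denotes v t a
  | _, .var i, _ => ⟨v i, rfl⟩
  | _, .app f t, h => by
    choose b hb using fun k => exists_denotes A hA v (t k) (h.2 k)
    exact ⟨(A.op f b).get (hA f h.1 b), b, hb, Part.get_mem _⟩

namespace Model

/-- For total symbols `Defined` is vacuous, so one criterion covers total and partial symbols and
later arguments need no case distinction. -/
theorem dom_iff_defined (M : Model.{u} T) (f : T.Op) (x : ∀ k, M.carrier (T.dom f k)) :
    (M.op f x).Dom ↔ Defined M.toPartialAlgebra f x := by
  by_cases hf : f ∈ T.total
  · exact ⟨fun _ h => absurd hf h, fun _ => M.op_total f hf x⟩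
  · rw [M.op_dom_iff f hf x]
    exact ⟨fun h _ => h, fun h => h hf⟩

@[simp]
theorem comp_app {M N P : Model.{u} T} (φ : M ⟶ N) (ψ : N ⟶ P) (s : T.Sorts)
    (x : M.carrier s) : Hom.app (φ ≫ ψ) s x = Hom.app ψ s (Hom.app φ s x) := rfl

theorem hom_ext {M N : Model.{u} T} {φ ψ : M ⟶ N}
    (h : ∀ s x, Hom.app φ s x = Hom.app ψ s x) : φ = ψ :=
  Hom.ext (funext fun s => funext fun x => h s x)

theorem denotes_map {M N : Model.{u} T} (φ : M ⟶ N) {n : ℕ} {Γ : Fin n → T.Sorts}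
    {v : ∀ i, M.carrier (Γ i)} {s : T.Sorts} (t : T.Term Γ s) {a : M.carrier s}
    (h : M.Denotes v t a) : N.Denotes (fun i => Hom.app φ _ (v i)) t (Hom.app φ _ a) :=
  PartialAlgebra.Denotes.map (Hom.app φ) (Hom.app_op φ) t h

/-- Injective morphisms of models reflect the operations. -/
theorem mem_op_of_injective {M N : Model.{u} T} (φ : M ⟶ N)
    (hφ : ∀ s, Function.Injective (Hom.app φ s)) {f : T.Op} {x : ∀ k, M.carrier (T.dom f k)}
    {a : M.carrier (T.cod f)} (h : Hom.app φ _ a ∈ N.op f (fun k => Hom.app φ _ (x k))) :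
    a ∈ M.op f x := by
  have hd : (M.op f x).Dom := by
    rw [dom_iff_defined]
    intro hf e he
    obtain ⟨b, hb₁, hb₂⟩ := (N.dom_iff_defined f _).1 h.1 hf e he
    -- Defining equations use total symbols only, so both sides already have values in `M`; these
    -- agree in `N`, and injectivity makes them agree in `M`.
    obtain ⟨c, hc⟩ := exists_denotes M.toPartialAlgebra M.op_total x e.lhs
      (T.defEqns_total f hf e he).1
    obtain ⟨d, hd⟩ := exists_denotes M.toPartialAlgebra M.op_total x e.rhs
      (T.defEqns_total f hf e he).2
    have : c = d := hφ _ (((denotes_map φ _ hc).unique _ _ hb₁).trans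
      (((denotes_map φ _ hd).unique _ _ hb₂).symm))
    exact ⟨c, hc, this ▸ hd⟩
  obtain ⟨b, hb⟩ := Part.dom_iff_mem.1 hd
  exact hφ _ (Part.mem_unique h (Hom.app_op φ _ _ _ hb)) ▸ hb

/-- A model whose operations are given by their graphs. -/
noncomputable def ofGraph (C : T.Sorts → Type u)
    (g : ∀ f : T.Op, (∀ k, C (T.dom f k)) → C (T.cod f) → Prop)
    (hd : ∀ f x, (∃ a, g f x a) ↔ Defined (PartialAlgebra.ofGraph C g) f x)
    (hh : ∀ e ∈ T.eqns, ∀ (v : ∀ i, C (e.2.1 i)) (a b : C e.2.2.sort),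
      (PartialAlgebra.ofGraph C g).Denotes v e.2.2.lhs a →
        (PartialAlgebra.ofGraph C g).Denotes v e.2.2.rhs b → a = b) : Model.{u} T where
  toPartialAlgebra := PartialAlgebra.ofGraph C g
  op_total f hf x := (hd f x).2 fun h => absurd hf h
  op_dom_iff f hf x := (hd f x).trans ⟨fun h => h hf, fun h _ => h⟩
  holds := hh

/-! ### Submodels -/

section Sub

variable (M : Model.{u} T) {C : T.Sorts → Type u} (k : ∀ s, C s → M.carrier s)

/-- The graphs of the operations induced along a family of maps to a model. -/
def subGraph (f : T.Op) (x : ∀ i, C (T.dom f i)) (a : C (T.cod f)) : Prop :=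
  k _ a ∈ M.op f (fun i => k _ (x i))

variable (hk : ∀ s, Function.Injective (k s))
  (hc : ∀ f (x : ∀ i, C (T.dom f i)) b, b ∈ M.op f (fun i => k _ (x i)) → ∃ a, k _ a = b)
include hk

theorem subGraph_unique (f : T.Op) (x : ∀ i, C (T.dom f i)) (a b : C (T.cod f))
    (ha : subGraph M k f x a) (hb : subGraph M k f x b) : a = b :=
  hk _ (Part.mem_unique ha hb)

include hc

theorem denotes_sub_iff {n : ℕ} {Γ : Fin n → T.Sorts} {v : ∀ i, C (Γ i)} :
    ∀ {s : T.Sorts} (t : T.Term Γ s) {a : C s},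
    (PartialAlgebra.ofGraph C (subGraph M k)).Denotes v t a ↔
      M.Denotes (fun i => k _ (v i)) t (k _ a)
  | _, .var i, _ => (hk _).eq_iff.symm
  | _, .app f t, a => by
    constructor
    · rintro ⟨b, hb, ha⟩
      exact ⟨fun i => k _ (b i), fun i => (denotes_sub_iff (t i)).1 (hb i),
        (PartialAlgebra.mem_op_ofGraph (subGraph_unique M k hk)).1 ha⟩
    · rintro ⟨b, hb, ha⟩
      -- The values of the subterms in `M` might lie outside the range of `k`; closure under the
      -- operations excludes this.
      have hex : ∀ {s : T.Sorts} (t : T.Term Γ s) (b : M.carrier s),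
          M.Denotes (fun i => k _ (v i)) t b → ∃ c, k _ c = b := by
        intro s t
        induction t with
        | var i => rintro b rfl; exact ⟨_, rfl⟩
        | app f t ih =>
          rintro b ⟨c, hc', hb⟩
          choose d hd using fun i => ih i (c i) (hc' i)
          obtain rfl : (fun i => k _ (d i)) = c := funext hd
          exact hc f d b hb
      choose c hc' using fun i => hex (t i) (b i) (hb i)
      obtain rfl : (fun i => k _ (c i)) = b := funext hc'
      exact ⟨c, fun i => (denotes_sub_iff (t i)).2 (hb i),
        (PartialAlgebra.mem_op_ofGraph (subGraph_unique M k hk)).2 ha⟩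

/-- The submodel of a model carried by an injective family of maps whose range is closed under
the operations. -/
noncomputable def sub : Model.{u} T :=
  ofGraph C (subGraph M k)
    (fun f x => by
      have h : (∃ a, subGraph M k f x a) ↔ (M.op f fun i => k _ (x i)).Dom := by
        constructor
        · rintro ⟨a, ha⟩
          exact Part.dom_iff_mem.2 ⟨_, ha⟩
        · intro h
          obtain ⟨b, hb⟩ := Part.dom_iff_mem.1 h
          obtain ⟨a, rfl⟩ := hc f x b hb
          exact ⟨a, hb⟩
      rw [h]
      constructor
      · rw [dom_iff_defined]
        intro h hf e he
        obtain ⟨b, hb₁, hb₂⟩ := h hf e he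
        -- The algebra on `C` is not yet known to be a model, so totality of its total operations is
        -- derived from closure.
        have hA : ∀ f ∈ T.total, ∀ x,
            ((PartialAlgebra.ofGraph C (subGraph M k)).op f x).Dom := by
          intro f hf x
          obtain ⟨b, hb⟩ := Part.dom_iff_mem.1 (M.op_total f hf fun i => k _ (x i))
          obtain ⟨a, rfl⟩ := hc f x b hb
          exact ⟨a, hb⟩
        -- The left side has a value `c` in `C`; its image must be the common value `b` of both
        -- sides in `M`.
        obtain ⟨c, hc'⟩ := exists_denotes _ hA x e.lhs (T.defEqns_total f hf e he).1
        refine ⟨c, hc', (denotes_sub_iff M k hk hc _).2 ?_⟩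
        have := ((denotes_sub_iff M k hk hc _).1 hc').unique _ _ hb₁
        rwa [this]
      · rw [dom_iff_defined]
        intro h hf e he
        obtain ⟨b, hb₁, hb₂⟩ := h hf e he
        exact ⟨_, (denotes_sub_iff M k hk hc _).1 hb₁, (denotes_sub_iff M k hk hc _).1 hb₂⟩)
    (fun e he v a b ha hb => hk _ (M.holds e he _ _ _
      ((denotes_sub_iff M k hk hc _).1 ha) ((denotes_sub_iff M k hk hc _).1 hb)))

theorem mem_op_sub {f : T.Op} {x : ∀ i, C (T.dom f i)} {a : C (T.cod f)} :
    a ∈ (sub M k hk hc).op f x ↔ k _ a ∈ M.op f (fun i => k _ (x i)) :=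
  PartialAlgebra.mem_op_ofGraph (subGraph_unique M k hk)

/-- The inclusion of a submodel. -/
noncomputable def subι : sub M k hk hc ⟶ M :=
  Hom.mk (M := sub M k hk hc) k (fun _ _ _ h => (mem_op_sub M k hk hc).1 h)

end Sub

/-! ### Products -/

section Pi

variable {J : Type u} (M : J → Model.{u} T)

/-- The graphs of the operations of a product of models. -/
def piGraph (f : T.Op) (x : ∀ i, ∀ j, (M j).carrier (T.dom f i))
    (a : ∀ j, (M j).carrier (T.cod f)) : Prop :=
  ∀ j, a j ∈ (M j).op f (fun i => x i j)

theorem piGraph_unique (f : T.Op) (x : ∀ i, ∀ j, (M j).carrier (T.dom f i))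
    (a b : ∀ j, (M j).carrier (T.cod f)) (ha : piGraph M f x a) (hb : piGraph M f x b) : a = b :=
  funext fun j => Part.mem_unique (ha j) (hb j)

theorem denotes_pi_iff {n : ℕ} {Γ : Fin n → T.Sorts} {v : ∀ i, ∀ j, (M j).carrier (Γ i)} :
    ∀ {s : T.Sorts} (t : T.Term Γ s) {a : ∀ j, (M j).carrier s},
    (PartialAlgebra.ofGraph (fun s => ∀ j, (M j).carrier s) (piGraph M)).Denotes v t a ↔
      ∀ j, (M j).Denotes (fun i => v i j) t (a j)
  | _, .var i, _ => funext_iff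
  | _, .app f t, a => by
    constructor
    · rintro ⟨b, hb, ha⟩ j
      exact ⟨fun i => b i j, fun i => (denotes_pi_iff (t i)).1 (hb i) j,
        (PartialAlgebra.mem_op_ofGraph (piGraph_unique M)).1 ha j⟩
    · intro h
      choose b hb ha using h
      exact ⟨fun i j => b j i, fun i => (denotes_pi_iff (t i)).2 fun j => hb j i,
        (PartialAlgebra.mem_op_ofGraph (piGraph_unique M)).2 ha⟩

/-- The product of a family of models. -/
noncomputable def pi : Model.{u} T :=
  ofGraph (fun s => ∀ j, (M j).carrier s) (piGraph M)
    (fun f x => by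
      have h : (∃ a, piGraph M f x a) ↔ ∀ j, ((M j).op f fun i => x i j).Dom := by
        simp only [Part.dom_iff_mem, Classical.skolem, piGraph]
      rw [h]
      simp only [dom_iff_defined]
      constructor
      · intro h hf e he
        choose a ha hb using fun j => h j hf e he
        exact ⟨a, (denotes_pi_iff M _).2 ha, (denotes_pi_iff M _).2 hb⟩
      · intro h j hf e he
        obtain ⟨a, ha, hb⟩ := h hf e he
        exact ⟨a j, (denotes_pi_iff M _).1 ha j, (denotes_pi_iff M _).1 hb j⟩)
    (fun e he v a b ha hb => funext fun j => (M j).holds e he _ _ _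
      ((denotes_pi_iff M _).1 ha j) ((denotes_pi_iff M _).1 hb j))

theorem mem_op_pi {f : T.Op} {x : ∀ i, (pi M).carrier (T.dom f i)}
    {a : (pi M).carrier (T.cod f)} : a ∈ (pi M).op f x ↔ ∀ j, a j ∈ (M j).op f (fun i => x i j) :=
  PartialAlgebra.mem_op_ofGraph (piGraph_unique M)

end Pi

end Model

end EssAlgTheory

namespace EssAlgTheory

variable {T : EssAlgTheory}

namespace Model

/-! ### Limits of models -/

section Limits

open Limits

/-- The functor which evaluates models at a sort. -/
def evaluation (T : EssAlgTheory) (s : T.Sorts) : Model.{u} T ⥤ Type u where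
  obj M := M.carrier s
  map φ := ↾(Hom.app φ s)

variable {J : Type u} [SmallCategory J] (F : J ⥤ Model.{u} T)

/-- Compatible families of elements of a diagram of models. -/
def LimitCarrier (s : T.Sorts) : Type u :=
  {x : ∀ j, (F.obj j).carrier s // ∀ ⦃i j⦄ (g : i ⟶ j), Hom.app (F.map g) s (x i) = x j}

/-- Transition maps preserve operations and values are unique, so a value computed componentwise on
compatible families is again compatible. -/
theorem limitCarrier_closed (f : T.Op) (x : ∀ i, LimitCarrier F (T.dom f i))
    (b : (pi F.obj).carrier (T.cod f))
    (hb : b ∈ (pi F.obj).op f (fun i => (x i).1)) : ∃ a : LimitCarrier F (T.cod f), a.1 = b := by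
  replace hb := (mem_op_pi F.obj).1 hb
  refine ⟨⟨b, fun i j g => ?_⟩, rfl⟩
  have h := Hom.app_op (F.map g) f _ _ (hb i)
  have e : (fun k => Hom.app (F.map g) _ ((x k).1 i)) = fun k => (x k).1 j :=
    funext fun k => (x k).2 g
  rw [e] at h
  exact Part.mem_unique h (hb j)

/-- The limit of a diagram of models. -/
noncomputable def limitModel : Model.{u} T :=
  sub (pi F.obj) (C := LimitCarrier F) (fun _ x => x.1) (fun _ => Subtype.val_injective)
    (limitCarrier_closed F)

theorem mem_op_limitModel {f : T.Op} {x : ∀ i, LimitCarrier F (T.dom f i)}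
    {a : LimitCarrier F (T.cod f)} :
    a ∈ (limitModel F).op f x ↔ ∀ j, a.1 j ∈ (F.obj j).op f (fun i => (x i).1 j) :=
  (mem_op_sub (pi F.obj) (C := LimitCarrier F) (fun _ x => x.1)
    (fun _ => Subtype.val_injective) (limitCarrier_closed F)).trans (mem_op_pi F.obj)

/-- The limit cone of a diagram of models. -/
noncomputable def limitCone : Cone F where
  pt := limitModel F
  π :=
    { app j := Hom.mk (M := limitModel F) (fun _ x => x.1 j)
        (fun _ _ _ h => (mem_op_limitModel F).1 h j)
      naturality _ _ g := hom_ext fun _ x => (x.2 g).symm }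

/-- The limit cone is a limit cone. -/
noncomputable def limitConeIsLimit : IsLimit (limitCone F) where
  lift c := Hom.mk (N := limitModel F)
    (fun s x => ⟨fun j => Hom.app (c.π.app j) s x, fun _ _ g => by
      rw [← comp_app, c.w]⟩)
    (fun f x a h => (mem_op_limitModel F).2 fun j => Hom.app_op (c.π.app j) f x a h)
  fac _ _ := rfl
  uniq c m h := hom_ext fun s x => Subtype.ext (funext fun j =>
    congrArg (fun φ : c.pt ⟶ F.obj j => Hom.app φ s x) (h j))

instance : HasLimits (Model.{u} T) where
  has_limits_of_shape _ _ := ⟨fun F => ⟨⟨⟨limitCone F, limitConeIsLimit F⟩⟩⟩⟩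

/-- The carrier of `limitModel` is the usual set of compatible families. This continuity is a
hypothesis of the adjoint functor theorem. -/
instance (s : T.Sorts) : PreservesLimits (evaluation.{u} T s) where
  preservesLimitsOfShape := ⟨fun {F} =>
    preservesLimit_of_preserves_limit_cone (limitConeIsLimit F)
      (Nonempty.some ((Types.isLimit_iff _).2 fun x hx =>
        ⟨(⟨x, fun _ _ g => hx g⟩ : LimitCarrier F s), fun _ => rfl,
          fun _ hy => Subtype.ext (funext hy)⟩))⟩

end Limits

/-! ### Submodels generated by families of elements -/

/-- Terms of arbitrary finite depth in possibly infinitely many generators. -/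
inductive GenTerm (T : EssAlgTheory) (X : T.Sorts → Type u) : T.Sorts → Type u
  | gen {s : T.Sorts} (x : X s) : GenTerm T X s
  | app (f : T.Op) (t : ∀ k, GenTerm T X (T.dom f k)) : GenTerm T X (T.cod f)

section Generated

variable (M : Model.{u} T) {X : T.Sorts → Type u} (e : ∀ s, X s → M.carrier s)

/-- The values of a term in a model. -/
def GenVal : ∀ {s : T.Sorts}, GenTerm T X s → M.carrier s → Prop
  | _, .gen x, a => e _ x = a
  | _, .app f t, a => ∃ b : ∀ k, M.carrier (T.dom f k), (∀ k, GenVal (t k) (b k)) ∧ a ∈ M.op f b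

theorem GenVal.unique : ∀ {s : T.Sorts} (t : GenTerm T X s) {a b : M.carrier s},
    GenVal M e t a → GenVal M e t b → a = b
  | _, .gen _, _, _, ha, hb => ha.symm.trans hb
  | _, .app f t, _, _, ⟨x, hx, ha⟩, ⟨y, hy, hb⟩ => by
    obtain rfl : x = y := funext fun k => GenVal.unique (t k) (hx k) (hy k)
    exact Part.mem_unique ha hb

/-- A set of terms whose values are precisely the elements generated by the family `e`, without
repetitions. -/
def genReps (s : T.Sorts) : Set (GenTerm T X s) :=
  {t | ∃ (a : M.carrier s) (h : ∃ t, GenVal M e t a), t = h.choose}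

theorem exists_genVal {s : T.Sorts} (t : genReps M e s) : ∃ a, GenVal M e t.1 a := by
  obtain ⟨_, a, h, rfl⟩ := t
  exact ⟨a, h.choose_spec⟩

/-- The values of the representing terms. -/
noncomputable def genRepsVal (s : T.Sorts) (t : genReps M e s) : M.carrier s :=
  (exists_genVal M e t).choose

theorem genVal_genRepsVal {s : T.Sorts} (t : genReps M e s) :
    GenVal M e t.1 (genRepsVal M e s t) :=
  (exists_genVal M e t).choose_spec

/-- Each generated element keeps one chosen term, so representatives with the same value are the
choice made for the same element. -/
theorem genRepsVal_injective (s : T.Sorts) : Function.Injective (genRepsVal M e s) := by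
  rintro ⟨_, a, h, rfl⟩ ⟨_, b, h', rfl⟩ hab
  have h₁ := (genVal_genRepsVal M e ⟨_, a, h, rfl⟩).unique M e _ h.choose_spec
  have h₂ := (genVal_genRepsVal M e ⟨_, b, h', rfl⟩).unique M e _ h'.choose_spec
  obtain rfl : a = b := h₁.symm.trans (hab.trans h₂)
  rfl

theorem exists_genRepsVal {s : T.Sorts} {t : GenTerm T X s} {a : M.carrier s}
    (h : GenVal M e t a) : ∃ r, genRepsVal M e s r = a :=
  have h' : ∃ t, GenVal M e t a := ⟨t, h⟩
  ⟨⟨h'.choose, a, h', rfl⟩, (genVal_genRepsVal M e _).unique M e _ h'.choose_spec⟩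

theorem genRepsVal_closed (f : T.Op) (x : ∀ i, genReps M e (T.dom f i)) (b : M.carrier (T.cod f))
    (hb : b ∈ M.op f (fun i => genRepsVal M e _ (x i))) :
    ∃ a, genRepsVal M e _ a = b :=
  exists_genRepsVal (t := .app f fun i => (x i).1) M e
    ⟨_, fun i => genVal_genRepsVal M e (x i), hb⟩

/-- The submodel generated by a family of elements. -/
noncomputable def generated : Model.{u} T :=
  sub M (C := fun s => genReps M e s) (genRepsVal M e) (genRepsVal_injective M e)
    (genRepsVal_closed M e)

/-- The inclusion of a generated submodel. -/
noncomputable def generatedι : generated M e ⟶ M :=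
  subι M (C := fun s => genReps M e s) (genRepsVal M e) (genRepsVal_injective M e)
    (genRepsVal_closed M e)

theorem generatedι_injective (s : T.Sorts) :
    Function.Injective (Hom.app (generatedι M e) s) :=
  genRepsVal_injective M e s

theorem exists_generatedι (s : T.Sorts) (x : X s) :
    ∃ a, Hom.app (generatedι M e) s a = e s x :=
  exists_genRepsVal (t := .gen x) M e rfl

end Generated

/-- Models carried by sets of terms in the generators `X`. -/
def TermModel (T : EssAlgTheory) (X : T.Sorts → Type u) : Type u :=
  Σ P : ∀ s, Set (GenTerm T X s),
    {op : ∀ f : T.Op, (∀ k, P (T.dom f k)) → Part (P (T.cod f)) //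
      ∃ N : Model.{u} T, N.toPartialAlgebra = ⟨fun s => P s, op⟩}

/-- The model underlying a term model. -/
noncomputable def TermModel.model {X : T.Sorts → Type u} (N : TermModel T X) : Model.{u} T :=
  N.2.2.choose

/-- Models form a large type, but operations on sets of terms in `X` form a type in `Type u`. So
`TermModel T X` is a small index set that still contains every submodel generated by a family
indexed by `X`. -/
theorem exists_termModel (M : Model.{u} T) {X : T.Sorts → Type u}
    (e : ∀ s, X s → M.carrier s) : ∃ N : TermModel T X, N.model = generated M e := by
  let N : TermModel T X := ⟨genReps M e, (generated M e).op, generated M e, rfl⟩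
  refine ⟨N, ?_⟩
  have h : N.model.toPartialAlgebra = (generated M e).toPartialAlgebra := N.2.2.choose_spec
  -- Besides the partial algebra a model has only propositional fields; with both models as
  -- variables the equality can be eliminated.
  generalize N.model = A at h
  generalize generated M e = B at h
  cases A
  cases B
  cases h
  rfl

/-- Every family of elements of a model lies in the image of an injective morphism from one of a
small set of models. -/
theorem exists_termModel_hom (M : Model.{u} T) {X : T.Sorts → Type u}
    (e : ∀ s, X s → M.carrier s) :
    ∃ (N : TermModel T X) (k : N.model ⟶ M), (∀ s, Function.Injective (Hom.app k s)) ∧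
      ∀ s x, ∃ a, Hom.app k s a = e s x := by
  obtain ⟨N, hN⟩ := exists_termModel M e
  refine ⟨N, ?_⟩
  generalize N.model = A at hN
  subst hN
  exact ⟨generatedι M e, generatedι_injective M e, exists_generatedι M e⟩

/-- Morphisms factor through injective morphisms containing their image. -/
theorem exists_lift {M N A : Model.{u} T} (k : N ⟶ M) (hk : ∀ s, Function.Injective (Hom.app k s))
    (φ : A ⟶ M) (hφ : ∀ s x, ∃ a, Hom.app k s a = Hom.app φ s x) : ∃ ψ : A ⟶ N, ψ ≫ k = φ := by
  choose g hg using hφ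
  refine ⟨Hom.mk g fun f x a h => mem_op_of_injective k hk ?_, hom_ext hg⟩
  have e : (fun i => Hom.app k _ (g _ (x i))) = fun i => Hom.app φ _ (x i) :=
    funext fun i => hg _ _
  rw [e, hg]
  exact Hom.app_op φ f x a h

theorem mono_of_injective {M N : Model.{u} T} (k : N ⟶ M)
    (hk : ∀ s, Function.Injective (Hom.app k s)) : Mono k where
  right_cancellation g h e := hom_ext fun s x => hk s (by
    rw [← comp_app, ← comp_app, e])

/-! ### Free models and colimits by the adjoint functor theorem -/

section Cocomplete

open Limits

/-- A map from `A` to a carrier factors through the submodel generated by its image, so term models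
with a map from `A` form a solution set. -/
instance (s : T.Sorts) : (evaluation.{u} T s).IsRightAdjoint := by
  classical
  refine isRightAdjoint_of_preservesLimits_of_solutionSetCondition _ fun A => ?_
  -- The generators are `A` in sort `s` and none in any other sort.
  let X : T.Sorts → Type u := fun s' => {_a : A // s' = s}
  refine ⟨Σ N : TermModel T X, (A ⟶ (evaluation T s).obj N.model), fun N => N.1.model,
    fun N => N.2, fun M h => ?_⟩
  obtain ⟨N, k, -, hk⟩ := exists_termModel_hom M (X := X) (fun s' x => x.2 ▸ h x.1)
  choose g hg using fun a => hk s ⟨a, rfl⟩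
  exact ⟨⟨N, ↾g⟩, k, by ext a; exact hg a⟩

/-- Colimits of shape `J` amount to a left adjoint of the constant diagram functor. A cocone on `F`
factors through the submodel generated by the images of all elements of the diagram. -/
instance : HasColimits (Model.{u} T) where
  has_colimits_of_shape J _ := by
    rw [hasColimitsOfShape_iff_isRightAdjoint_const]
    refine isRightAdjoint_of_preservesLimits_of_solutionSetCondition _ fun F => ?_
    let X : T.Sorts → Type u := fun s => Σ j, (F.obj j).carrier s
    refine ⟨Σ N : TermModel T X, (F ⟶ (Functor.const J).obj N.model), fun N => N.1.model,
      fun N => N.2, fun M h => ?_⟩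
    obtain ⟨N, k, hk, hk'⟩ := exists_termModel_hom M (X := X) (fun s x => Hom.app (h.app x.1) s x.2)
    have := mono_of_injective k hk
    choose g hg using fun j => exists_lift k hk (h.app j) (fun s x => hk' s ⟨j, x⟩)
    refine ⟨⟨N, { app := g, naturality := fun i j f => ?_ }⟩, k, ?_⟩
    -- The components are lifts through the monomorphism `k`, so naturality may be checked after
    -- composing with it.
    · rw [← cancel_mono k, Category.assoc, hg]
      simp [hg]
    · ext j : 2
      exact hg j

end Cocomplete

end Model

end EssAlgTheory

/-! ### Filtered colimits of models -/

/-- In a filtered category, finitely many properties of morphisms out of `j₀`, each stable under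
postcomposition and satisfied by some morphism, are simultaneously satisfied. -/
theorem IsFiltered.exists_forall {J : Type u} [SmallCategory J] [IsFiltered J] {j₀ : J}
    {K : Type*} [Finite K] (Φ : K → ∀ j, (j₀ ⟶ j) → Prop)
    (mono : ∀ k j j' (g : j₀ ⟶ j) (h : j ⟶ j'), Φ k j g → Φ k j' (g ≫ h))
    (hΦ : ∀ k, ∃ j g, Φ k j g) : ∃ j g, ∀ k, Φ k j g := by
  classical
  have := Fintype.ofFinite K
  suffices h : ∀ S : Finset K, ∃ j g, ∀ k ∈ S, Φ k j g by
    obtain ⟨j, g, h⟩ := h Finset.univ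
    exact ⟨j, g, fun k => h k (Finset.mem_univ k)⟩
  intro S
  induction S using Finset.induction_on with
  | empty => exact ⟨j₀, 𝟙 _, by simp⟩
  | insert k S _ ih =>
    obtain ⟨j, g, hg⟩ := ih
    obtain ⟨j', g', hg'⟩ := hΦ k
    obtain ⟨l, a, b, hab⟩ := IsFiltered.span g g'
    refine ⟨l, g ≫ a, fun k' hk' => ?_⟩
    rcases Finset.mem_insert.1 hk' with rfl | hk'
    · rw [hab]
      exact mono _ _ _ _ _ hg'
    · exact mono _ _ _ _ _ (hg k' hk')

namespace EssAlgTheory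

variable {T : EssAlgTheory}

namespace Model

open Limits

section FilteredColimit

variable {J : Type u} [SmallCategory J] (F : J ⥤ Model.{u} T)

/-- The elements of a filtered colimit of models. -/
noncomputable def ColimCarrier (s : T.Sorts) : Type u :=
  colimit (F ⋙ evaluation T s)

/-- The map from a stage of a diagram of models to the colimit. -/
noncomputable def toColim (j : J) {s : T.Sorts} (x : (F.obj j).carrier s) : ColimCarrier F s :=
  colimit.ι (F ⋙ evaluation T s) j x

theorem toColim_map {j j' : J} (g : j ⟶ j') {s : T.Sorts} (x : (F.obj j).carrier s) :
    toColim F j' (Hom.app (F.map g) s x) = toColim F j x :=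
  ConcreteCategory.congr_hom (colimit.w (F ⋙ evaluation T s) g) x

theorem evaluation_desc_toColim (c : Cocone F) {j : J} {s : T.Sorts} (x : (F.obj j).carrier s) :
    colimit.desc (F ⋙ evaluation T s) ((evaluation T s).mapCocone c) (toColim F j x) =
      Hom.app (c.ι.app j) s x :=
  ConcreteCategory.congr_hom
    (colimit.ι_desc (F := F ⋙ evaluation T s) ((evaluation T s).mapCocone c) j) x

theorem exists_toColim {s : T.Sorts} (q : ColimCarrier F s) : ∃ j x, toColim F j x = q :=
  Types.jointly_surjective_of_isColimit (colimit.isColimit (F ⋙ evaluation T s)) q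

theorem map_comp_app {i j k : J} (g : i ⟶ j) (h : j ⟶ k) {s : T.Sorts}
    (x : (F.obj i).carrier s) :
    Hom.app (F.map (g ≫ h)) s x = Hom.app (F.map h) s (Hom.app (F.map g) s x) := by
  rw [F.map_comp, comp_app]

variable [IsFiltered J]

theorem toColim_eq_iff {j : J} {s : T.Sorts} (x y : (F.obj j).carrier s) :
    toColim F j x = toColim F j y ↔
      ∃ (j' : J) (g : j ⟶ j'), Hom.app (F.map g) s x = Hom.app (F.map g) s y :=
  Types.FilteredColimit.isColimit_eq_iff' (colimit.isColimit (F ⋙ evaluation T s)) x y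

/-- Finitely many elements of a filtered colimit live at a common stage. -/
theorem exists_toColim_pi {n : ℕ} {Γ : Fin n → T.Sorts} (q : ∀ i, ColimCarrier F (Γ i)) :
    ∃ (j : J) (x : ∀ i, (F.obj j).carrier (Γ i)), (fun i => toColim F j (x i)) = q := by
  classical
  choose j x hx using fun i => exists_toColim F (q i)
  obtain ⟨m, hm⟩ := IsFiltered.sup_objs_exists (Finset.univ.image j)
  let g (i : Fin n) : j i ⟶ m := (hm (Finset.mem_image_of_mem j (Finset.mem_univ i))).some
  exact ⟨m, fun i => Hom.app (F.map (g i)) _ (x i), funext fun i => by rw [toColim_map, hx]⟩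

/-- Finitely many equalities in a filtered colimit hold at a common later stage. -/
theorem exists_map_eq {n : ℕ} {Γ : Fin n → T.Sorts} {j : J} (x y : ∀ i, (F.obj j).carrier (Γ i))
    (h : (fun i => toColim F j (x i)) = fun i => toColim F j (y i)) :
    ∃ (j' : J) (g : j ⟶ j'),
      (fun i => Hom.app (F.map g) _ (x i)) = fun i => Hom.app (F.map g) _ (y i) := by
  simp only [funext_iff] at h ⊢
  refine IsFiltered.exists_forall
    (fun i j' g => Hom.app (F.map g) _ (x i) = Hom.app (F.map g) _ (y i)) ?_
    fun i => (toColim_eq_iff F _ _).1 (h i)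
  intro i _ _ g h hg
  simp only [map_comp_app, hg]

/-- The graphs of the operations of a filtered colimit of models. -/
def colimGraph (f : T.Op) (x : ∀ i, ColimCarrier F (T.dom f i)) (a : ColimCarrier F (T.cod f)) :
    Prop :=
  ∃ (j : J) (x' : ∀ i, (F.obj j).carrier (T.dom f i)) (a' : (F.obj j).carrier (T.cod f)),
    a' ∈ (F.obj j).op f x' ∧ (fun i => toColim F j (x' i)) = x ∧ toColim F j a' = a

/-- The operations of a filtered colimit can be computed after a given stage. -/
theorem colimGraph_toColim_iff {f : T.Op} {j : J} {x : ∀ i, (F.obj j).carrier (T.dom f i)}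
    {a : ColimCarrier F (T.cod f)} :
    colimGraph F f (fun i => toColim F j (x i)) a ↔
      ∃ (j' : J) (g : j ⟶ j') (a' : (F.obj j').carrier (T.cod f)),
        a' ∈ (F.obj j').op f (fun i => Hom.app (F.map g) _ (x i)) ∧ toColim F j' a' = a := by
  constructor
  · rintro ⟨i, y, b, hb, hy, rfl⟩
    obtain ⟨m, gi, gj, -⟩ := IsFilteredOrEmpty.cocone_objs i j
    obtain ⟨m', h, hm⟩ := exists_map_eq F (j := m) (fun k => Hom.app (F.map gi) _ (y k))
      (fun k => Hom.app (F.map gj) _ (x k)) (by simpa only [toColim_map] using hy)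
    refine ⟨m', gj ≫ h, Hom.app (F.map (gi ≫ h)) _ b, ?_, toColim_map F _ _⟩
    simp only [map_comp_app]
    rw [← hm]
    exact Hom.app_op _ _ _ _ (Hom.app_op _ _ _ _ hb)
  · rintro ⟨j', g, a', ha', rfl⟩
    exact ⟨j', _, a', ha', by simp only [toColim_map], rfl⟩

/-- Two witnesses can be moved to a common stage with the same arguments, where the operation is
single-valued. -/
theorem colimGraph_unique (f : T.Op) (x : ∀ i, ColimCarrier F (T.dom f i))
    (a b : ColimCarrier F (T.cod f)) (ha : colimGraph F f x a) (hb : colimGraph F f x b) :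
    a = b := by
  obtain ⟨j, x, a, ha, rfl, rfl⟩ := ha
  obtain ⟨j', g, b, hb', rfl⟩ := (colimGraph_toColim_iff F).1 hb
  obtain rfl := Part.mem_unique (Hom.app_op (F.map g) _ _ _ ha) hb'
  rw [toColim_map]

theorem denotes_toColim {j : J} {n : ℕ} {Γ : Fin n → T.Sorts}
    {v : ∀ i, (F.obj j).carrier (Γ i)} {s : T.Sorts} (t : T.Term Γ s)
    {a : (F.obj j).carrier s} (h : (F.obj j).Denotes v t a) :
    (PartialAlgebra.ofGraph (ColimCarrier F) (colimGraph F)).Denotes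
      (fun i => toColim F j (v i)) t (toColim F j a) :=
  PartialAlgebra.Denotes.map (B := PartialAlgebra.ofGraph (ColimCarrier F) (colimGraph F))
    (fun _ x => toColim F j x) (fun _ _ _ h =>
      (PartialAlgebra.mem_op_ofGraph (colimGraph_unique F)).2 ⟨j, _, _, h, rfl, rfl⟩) t h

/-- An evaluation in the colimit involves finitely many elements and operations. By induction on the
term, the stages found for the finitely many arguments are merged, and one further stage provides
the outer operation. This is where finite arity is essential. -/
theorem exists_denotes_of_colim {j : J} {n : ℕ} {Γ : Fin n → T.Sorts}
    {v : ∀ i, (F.obj j).carrier (Γ i)} : ∀ {s : T.Sorts} (t : T.Term Γ s) {a : ColimCarrier F s},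
    (PartialAlgebra.ofGraph (ColimCarrier F) (colimGraph F)).Denotes
      (fun i => toColim F j (v i)) t a →
    ∃ (j' : J) (g : j ⟶ j') (a' : (F.obj j').carrier s),
      (F.obj j').Denotes (fun i => Hom.app (F.map g) _ (v i)) t a' ∧ toColim F j' a' = a
  | _, .var i, a, h => ⟨j, 𝟙 j, _, rfl, by
      rw [toColim_map]
      exact h⟩
  | _, .app f t, a, ⟨b, hb, ha⟩ => by
    obtain ⟨j', g, h⟩ := IsFiltered.exists_forall (j₀ := j)
      (fun k j' g => ∃ b' : (F.obj j').carrier (T.dom f k),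
        (F.obj j').Denotes (fun i => Hom.app (F.map g) _ (v i)) (t k) b' ∧ toColim F j' b' = b k)
      (by
        rintro k j₁ j₂ g h ⟨b', hb', hb''⟩
        refine ⟨Hom.app (F.map h) _ b', ?_, by rw [toColim_map, hb'']⟩
        simpa only [map_comp_app] using denotes_map (F.map h) _ hb')
      (fun k => exists_denotes_of_colim (t k) (hb k))
    choose b' hb' hb'' using h
    obtain rfl : (fun k => toColim F j' (b' k)) = b := funext hb''
    obtain ⟨m, h, a', ha', rfl⟩ := (colimGraph_toColim_iff F).1
      ((PartialAlgebra.mem_op_ofGraph (colimGraph_unique F)).1 ha)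
    refine ⟨m, g ≫ h, a', ⟨_, fun k => ?_, ha'⟩, rfl⟩
    simpa only [map_comp_app] using denotes_map (F.map h) _ (hb' k)

/-- Two terms with a common value in a filtered colimit have a common value at some stage. -/
theorem exists_denotes_of_colim₂ {j : J} {n : ℕ} {Γ : Fin n → T.Sorts}
    {v : ∀ i, (F.obj j).carrier (Γ i)} {s : T.Sorts} (t t' : T.Term Γ s) {a b : ColimCarrier F s}
    (ha : (PartialAlgebra.ofGraph (ColimCarrier F) (colimGraph F)).Denotes
      (fun i => toColim F j (v i)) t a)
    (hb : (PartialAlgebra.ofGraph (ColimCarrier F) (colimGraph F)).Denotes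
      (fun i => toColim F j (v i)) t' b) :
    ∃ (j' : J) (g : j ⟶ j') (a' b' : (F.obj j').carrier s),
      (F.obj j').Denotes (fun i => Hom.app (F.map g) _ (v i)) t a' ∧
      (F.obj j').Denotes (fun i => Hom.app (F.map g) _ (v i)) t' b' ∧
      toColim F j' a' = a ∧ toColim F j' b' = b := by
  obtain ⟨j₁, g₁, a', ha', rfl⟩ := exists_denotes_of_colim F t ha
  obtain ⟨j₂, g₂, b', hb', rfl⟩ := exists_denotes_of_colim F t' hb
  obtain ⟨m, h₁, h₂, e⟩ := IsFiltered.span g₁ g₂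
  refine ⟨m, g₁ ≫ h₁, Hom.app (F.map h₁) _ a', Hom.app (F.map h₂) _ b', ?_, ?_,
    toColim_map F _ _, toColim_map F _ _⟩
  · simpa only [map_comp_app] using denotes_map (F.map h₁) _ ha'
  · rw [e]
    simpa only [map_comp_app] using denotes_map (F.map h₂) _ hb'

/-- The filtered colimit of a diagram of models. -/
noncomputable def colimModel : Model.{u} T :=
  ofGraph (ColimCarrier F) (colimGraph F)
    (fun f x => by
      obtain ⟨j, x, rfl⟩ := exists_toColim_pi F x
      constructor
      · rintro ⟨a, ha⟩ hf e he
        obtain ⟨j', g, a', ha', -⟩ := (colimGraph_toColim_iff F).1 ha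
        obtain ⟨b, hb₁, hb₂⟩ := (dom_iff_defined _ _ _).1 (Part.dom_iff_mem.2 ⟨a', ha'⟩) hf e he
        refine ⟨toColim F j' b, ?_, ?_⟩
        · simpa only [toColim_map] using denotes_toColim F _ hb₁
        · simpa only [toColim_map] using denotes_toColim F _ hb₂
      · intro h
        -- Since the defining equations form a list, the index type `K` is finite; it is empty when
        -- `f` is total. A single stage therefore satisfies all of them.
        obtain ⟨j', g, h⟩ := IsFiltered.exists_forall (j₀ := j)
          (K := Σ' (hf : f ∉ T.total), Fin (T.defEqns f hf).length)
          (fun k j' g => ∃ a : (F.obj j').carrier _,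
            (F.obj j').Denotes (fun i => Hom.app (F.map g) _ (x i))
              ((T.defEqns f k.1).get k.2).lhs a ∧
            (F.obj j').Denotes (fun i => Hom.app (F.map g) _ (x i))
              ((T.defEqns f k.1).get k.2).rhs a)
          (by
            rintro k j₁ j₂ g h ⟨a, ha₁, ha₂⟩
            refine ⟨Hom.app (F.map h) _ a, ?_, ?_⟩
            · simpa only [map_comp_app] using denotes_map (F.map h) _ ha₁
            · simpa only [map_comp_app] using denotes_map (F.map h) _ ha₂)
          (by
            intro k
            obtain ⟨a, ha₁, ha₂⟩ := h k.1 _ (List.get_mem _ k.2)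
            obtain ⟨j₁, g, b, c, hb, hc, rfl, hbc⟩ := exists_denotes_of_colim₂ F _ _ ha₁ ha₂
            -- The two sides `b` and `c` agree only in the colimit, so one more transition map is
            -- needed to make them equal.
            obtain ⟨j₂, h, e⟩ := (toColim_eq_iff F _ _).1 hbc
            refine ⟨j₂, g ≫ h, Hom.app (F.map h) _ b, ?_, ?_⟩
            · simpa only [map_comp_app] using denotes_map (F.map h) _ hb
            · rw [← e]
              simpa only [map_comp_app] using denotes_map (F.map h) _ hc)
        obtain ⟨a, ha⟩ := Part.dom_iff_mem.1 (((F.obj j').dom_iff_defined f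
          (fun i => Hom.app (F.map g) _ (x i))).2 fun hf e he => by
            obtain ⟨i, rfl⟩ := List.get_of_mem he
            exact h ⟨hf, i⟩)
        exact ⟨_, (colimGraph_toColim_iff F).2 ⟨j', g, a, ha, rfl⟩⟩)
    (fun e he v a b ha hb => by
      obtain ⟨j, v, rfl⟩ := exists_toColim_pi F v
      obtain ⟨j', g, a, b, ha', hb', rfl, rfl⟩ := exists_denotes_of_colim₂ F _ _ ha hb
      rw [(F.obj j').holds e he _ _ _ ha' hb'])

theorem mem_op_colimModel {f : T.Op} {x : ∀ i, ColimCarrier F (T.dom f i)}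
    {a : ColimCarrier F (T.cod f)} : a ∈ (colimModel F).op f x ↔ colimGraph F f x a :=
  PartialAlgebra.mem_op_ofGraph (colimGraph_unique F)

/-- The colimit cocone of a filtered diagram of models. -/
noncomputable def colimCocone : Cocone F where
  pt := colimModel F
  ι :=
    { app j := Hom.mk (N := colimModel F) (fun _ x => toColim F j x)
        (fun _ _ _ h => (mem_op_colimModel F).2 ⟨j, _, _, h, rfl, rfl⟩)
      naturality _ _ g := hom_ext fun _ x => toColim_map F g x }

/-- The colimit cocone of a filtered diagram of models is a colimit cocone. -/
noncomputable def colimCoconeIsColimit : IsColimit (colimCocone F) where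
  desc c := Hom.mk (M := colimModel F)
    (fun s x => colimit.desc (F ⋙ evaluation T s) ((evaluation T s).mapCocone c) x)
    (fun f x a h => by
      obtain ⟨j, x, a, h', rfl, rfl⟩ := (mem_op_colimModel F).1 h
      simp only [evaluation_desc_toColim]
      exact Hom.app_op (c.ι.app j) f x a h')
  fac c j := hom_ext fun s x => evaluation_desc_toColim F c x
  uniq c m h := hom_ext fun s x => by
    obtain ⟨j, x, rfl⟩ := exists_toColim F x
    exact (congrArg (fun φ : F.obj j ⟶ c.pt => Hom.app φ s x) (h j)).trans
      (evaluation_desc_toColim F c x).symm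

/-- The carriers of `colimModel` are by construction the colimits of sets. -/
instance (s : T.Sorts) : PreservesColimitsOfShape J (evaluation.{u} T s) :=
  ⟨fun {F} => preservesColimit_of_preserves_colimit_cocone (colimCoconeIsColimit F)
    (colimit.isColimit (F ⋙ evaluation T s))⟩

end FilteredColimit

/-! ### Local finite presentability -/

section Presentable

attribute [local instance] Cardinal.fact_isRegular_aleph0

open Cardinal

instance (s : T.Sorts) : (evaluation.{u} T s).IsCardinalAccessible (ℵ₀ : Cardinal.{u}) where
  preservesColimitOfShape J _ _ := by
    have := isFiltered_of_isCardinalFiltered J ℵ₀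
    infer_instance

/-- The free model on one generator of sort `s`. -/
noncomputable def free (T : EssAlgTheory) (s : T.Sorts) : Model.{u} T :=
  (evaluation T s).leftAdjoint.obj PUnit

/-- Morphisms from the free model on one generator are elements. -/
noncomputable def freeHomEquiv (s : T.Sorts) (M : Model.{u} T) :
    (free T s ⟶ M) ≃ (PUnit.{u + 1} ⟶ (evaluation T s).obj M) :=
  (Adjunction.ofIsRightAdjoint (evaluation T s)).homEquiv _ _

theorem freeHomEquiv_comp {s : T.Sorts} {M N : Model.{u} T} (g : free T s ⟶ M) (φ : M ⟶ N) :
    freeHomEquiv s N (g ≫ φ) = freeHomEquiv s M g ≫ (evaluation T s).map φ :=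
  Adjunction.homEquiv_naturality_right _ _ _

theorem exists_hom_free {s : T.Sorts} {M : Model.{u} T} (x : M.carrier s) :
    ∃ g : free T s ⟶ M, freeHomEquiv s M g = ↾fun _ => x :=
  (freeHomEquiv s M).surjective _

/-- For arbitrary partial algebras this fails, as the inverse may not preserve definedness. Here
injective morphisms reflect the operations, so the identity of `N` lifts through `φ`. -/
theorem isIso_of_bijective {M N : Model.{u} T} (φ : M ⟶ N)
    (h : ∀ s, Function.Bijective (Hom.app φ s)) : IsIso φ := by
  obtain ⟨ψ, hψ⟩ := exists_lift φ (fun s => (h s).1) (𝟙 N) fun s x => (h s).2 x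
  have := mono_of_injective φ fun s => (h s).1
  exact ⟨ψ, by rw [← cancel_mono φ, Category.assoc, hψ, Category.comp_id, Category.id_comp], hψ⟩

/-- Morphisms out of `free T s` are the elements of sort `s`. So they separate morphisms, and a
monomorphism through which all of them factor is bijective in each sort. -/
theorem isStrongGenerator_free :
    (ObjectProperty.ofObj (free.{u} T)).IsStrongGenerator := by
  rw [ObjectProperty.isStrongGenerator_iff]
  constructor
  · intro M N φ ψ h
    refine hom_ext fun s x => ?_
    obtain ⟨g, hg⟩ := exists_hom_free x
    have := congrArg (freeHomEquiv s N) (h (free T s) (ObjectProperty.ofObj_apply _ s) g)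
    rw [freeHomEquiv_comp, freeHomEquiv_comp, hg] at this
    exact ConcreteCategory.congr_hom this PUnit.unit
  · intro M N φ _ h
    refine isIso_of_bijective φ fun s => ⟨fun x y hxy => ?_, fun y => ?_⟩
    · obtain ⟨g, hg⟩ := exists_hom_free x
      obtain ⟨g', hg'⟩ := exists_hom_free y
      have : g = g' := by
        rw [← cancel_mono φ]
        apply (freeHomEquiv s N).injective
        rw [freeHomEquiv_comp, freeHomEquiv_comp, hg, hg']
        ext
        exact hxy
      subst this
      exact ConcreteCategory.congr_hom (hg.symm.trans hg') PUnit.unit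
    · obtain ⟨g, hg⟩ := exists_hom_free y
      obtain ⟨g', rfl⟩ := h _ (ObjectProperty.ofObj_apply _ s) g
      refine ⟨freeHomEquiv s M g' PUnit.unit, ?_⟩
      rw [freeHomEquiv_comp] at hg
      exact ConcreteCategory.congr_hom hg PUnit.unit

/-- The category of models of a finitary essentially algebraic theory is locally finitely
presentable. -/
instance : IsLocallyFinitelyPresentable.{u} (Model.{u} T) := by
  refine (IsCardinalLocallyPresentable.iff_exists_isStrongGenerator _ _).2
    ⟨_, inferInstance, isStrongGenerator_free, ?_⟩
  rintro _ ⟨s⟩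
  rw [isCardinalPresentable_iff]
  -- A point is a finitely presentable set, and the left adjoint of a functor preserving filtered
  -- colimits preserves finite presentability.
  have : IsCardinalPresentable PUnit.{u + 1} (ℵ₀ : Cardinal.{u}) :=
    (hasCardinalLT_of_finite _ _ le_rfl).isCardinalPresentable
  exact (Adjunction.ofIsRightAdjoint (evaluation T s)).isCardinalPresentable_leftAdjoint_obj ℵ₀ _

end Presentable

end Model

end EssAlgTheory

/-! ### Iterated domains, codomains and identities -/

namespace GlobularSet

variable (X : GlobularSet.{u})

theorem domTo_succ {i j : ℕ} (h : i ≤ j) (x : X.cell (j + 1)) :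
    X.domTo (h.trans j.le_succ) x = X.domTo h (X.dom j x) := by
  unfold domTo
  rw [Nat.leRec_succ _ _ h]

theorem codTo_succ {i j : ℕ} (h : i ≤ j) (x : X.cell (j + 1)) :
    X.codTo (h.trans j.le_succ) x = X.codTo h (X.cod j x) := by
  unfold codTo
  rw [Nat.leRec_succ _ _ h]

/-- The strict inequality leaves at least one more domain to take, to which the globular identity
applies. -/
theorem domTo_cod {i j : ℕ} (h : i < j) (x : X.cell (j + 1)) :
    X.domTo h.le (X.cod j x) = X.domTo h.le (X.dom j x) := by
  cases j with
  | zero => exact absurd h (Nat.not_lt_zero _)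
  | succ k =>
    have h' := Nat.le_of_lt_succ h
    exact (X.domTo_succ h' _).trans ((congrArg _ (X.dom_dom k x).symm).trans
      (X.domTo_succ h' _).symm)

theorem codTo_dom {i j : ℕ} (h : i < j) (x : X.cell (j + 1)) :
    X.codTo h.le (X.dom j x) = X.codTo h.le (X.cod j x) := by
  cases j with
  | zero => exact absurd h (Nat.not_lt_zero _)
  | succ k =>
    have h' := Nat.le_of_lt_succ h
    exact (X.codTo_succ h' _).trans ((congrArg _ (X.cod_dom k x)).trans
      (X.codTo_succ h' _).symm)

-- Bare families of maps are allowed, since this is applied to `lam` and `kappa` while they are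
-- still being shown to preserve composition.
variable {X} in
theorem map_domTo {Y : GlobularSet.{u}} (φ : ∀ i, X.cell i → Y.cell i)
    (hφ : ∀ i x, φ i (X.dom i x) = Y.dom i (φ (i + 1) x)) {i j : ℕ} (h : i ≤ j) (x : X.cell j) :
    φ i (X.domTo h x) = Y.domTo h (φ j x) := by
  induction h with
  | refl => simp [domTo, Nat.leRec_self]
  | step h ih =>
    exact (congrArg _ (X.domTo_succ h x)).trans
      ((ih _).trans ((congrArg _ (hφ _ x)).trans (Y.domTo_succ h _).symm))

variable {X} in
theorem map_codTo {Y : GlobularSet.{u}} (φ : ∀ i, X.cell i → Y.cell i)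
    (hφ : ∀ i x, φ i (X.cod i x) = Y.cod i (φ (i + 1) x)) {i j : ℕ} (h : i ≤ j) (x : X.cell j) :
    φ i (X.codTo h x) = Y.codTo h (φ j x) := by
  induction h with
  | refl => simp [codTo, Nat.leRec_self]
  | step h ih =>
    exact (congrArg _ (X.codTo_succ h x)).trans
      ((ih _).trans ((congrArg _ (hφ _ x)).trans (Y.codTo_succ h _).symm))

end GlobularSet

namespace OmegaGraph

variable (X : OmegaGraph.{u})

theorem idTo_succ {i j : ℕ} (h : i ≤ j) (x : X.cell i) :
    X.idTo (h.trans j.le_succ) x = X.idn j (X.idTo h x) := by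
  unfold idTo
  rw [Nat.leRec_succ _ _ h]

theorem domTo_idTo {i j : ℕ} (h : i ≤ j) (x : X.cell i) : X.domTo h (X.idTo h x) = x := by
  induction h with
  | refl => simp [GlobularSet.domTo, idTo, Nat.leRec_self]
  | step h ih =>
    exact (X.domTo_succ h _).trans (((congrArg _ (congrArg _ (X.idTo_succ h x))).trans
      (congrArg _ (X.dom_idn _ _))).trans ih)

theorem codTo_idTo {i j : ℕ} (h : i ≤ j) (x : X.cell i) : X.codTo h (X.idTo h x) = x := by
  induction h with
  | refl => simp [GlobularSet.codTo, idTo, Nat.leRec_self]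
  | step h ih =>
    exact (X.codTo_succ h _).trans (((congrArg _ (congrArg _ (X.idTo_succ h x))).trans
      (congrArg _ (X.cod_idn _ _))).trans ih)

end OmegaGraph

/-! ### The essentially algebraic theory of weak omega categories -/

namespace OmegaTheory

/-- The operation symbols of the theory of weak omega categories. The sort `(m, n)` is the sort of
`n`-cells of the `m`-th magma. -/
inductive OpSym : Type
  | dom (m : Fin 3) (n : ℕ)
  | cod (m : Fin 3) (n : ℕ)
  | idn (m : Fin 3) (n : ℕ)
  | lam (n : ℕ)
  | rho (n : ℕ)
  | kappa (n : ℕ)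
  | comp (m : Fin 3) (i j : ℕ) (h : i < j)
  | bridge (n : ℕ)

namespace OpSym

/-- The number of arguments of an operation symbol. -/
def arity : OpSym → ℕ
  | comp .. | bridge _ => 2
  | _ => 1

/-- The sort of the arguments of an operation symbol. -/
def src : OpSym → Fin 3 × ℕ
  | dom m n | cod m n => (m, n + 1)
  | idn m n => (m, n)
  | lam n | kappa n | bridge n => (1, n)
  | rho n => (0, n)
  | comp m _ j _ => (m, j)

/-- The sort of the values of an operation symbol. -/
def tgt : OpSym → Fin 3 × ℕ
  | dom m n | cod m n => (m, n)
  | idn m n => (m, n + 1)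
  | lam n => (0, n)
  | kappa n => (2, n)
  | bridge n => (1, n + 1)
  | rho n => (1, n)
  | comp m _ j _ => (m, j)

/-- Compositions and bridges are the partial operations. -/
def IsTotal : OpSym → Prop
  | comp .. | bridge _ => False
  | _ => True

end OpSym

/-- The signature of the theory of weak omega categories. -/
def sig : FinSignature where
  Sorts := Fin 3 × ℕ
  Op := OpSym
  arity := OpSym.arity
  dom f _ := f.src
  cod := OpSym.tgt

section Terms

variable {n : ℕ} {Γ : Fin n → sig.Sorts}

def tDom (m : Fin 3) (k : ℕ) (t : sig.Term Γ (m, k + 1)) : sig.Term Γ (m, k) :=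
  .app (S := sig) (.dom m k) fun _ => t

def tCod (m : Fin 3) (k : ℕ) (t : sig.Term Γ (m, k + 1)) : sig.Term Γ (m, k) :=
  .app (S := sig) (.cod m k) fun _ => t

def tIdn (m : Fin 3) (k : ℕ) (t : sig.Term Γ (m, k)) : sig.Term Γ (m, k + 1) :=
  .app (S := sig) (.idn m k) fun _ => t

def tLam (k : ℕ) (t : sig.Term Γ (1, k)) : sig.Term Γ (0, k) :=
  .app (S := sig) (.lam k) fun _ => t

def tRho (k : ℕ) (t : sig.Term Γ (0, k)) : sig.Term Γ (1, k) :=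
  .app (S := sig) (.rho k) fun _ => t

def tKappa (k : ℕ) (t : sig.Term Γ (1, k)) : sig.Term Γ (2, k) :=
  .app (S := sig) (.kappa k) fun _ => t

def tComp (m : Fin 3) (i j : ℕ) (h : i < j) (t t' : sig.Term Γ (m, j)) : sig.Term Γ (m, j) :=
  .app (S := sig) (.comp m i j h) (![t, t'] : Fin 2 → sig.Term Γ (m, j))

def tBridge (k : ℕ) (t t' : sig.Term Γ (1, k)) : sig.Term Γ (1, k + 1) :=
  .app (S := sig) (.bridge k) (![t, t'] : Fin 2 → sig.Term Γ (1, k))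

/-- The recursion is the one defining the iterated domain of cells, so that a parallel induction
evaluates it in `den_domTo`. -/
def tDomTo (m : Fin 3) {i j : ℕ} (h : i ≤ j) : sig.Term Γ (m, j) → sig.Term Γ (m, i) :=
  Nat.leRec (motive := fun j _ => sig.Term Γ (m, j) → sig.Term Γ (m, i)) (fun t => t)
    (fun {k} _ f t => f (tDom m k t)) h

def tCodTo (m : Fin 3) {i j : ℕ} (h : i ≤ j) : sig.Term Γ (m, j) → sig.Term Γ (m, i) :=
  Nat.leRec (motive := fun j _ => sig.Term Γ (m, j) → sig.Term Γ (m, i)) (fun t => t)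
    (fun {k} _ f t => f (tCod m k t)) h

def tIdTo (m : Fin 3) {i j : ℕ} (h : i ≤ j) : sig.Term Γ (m, i) → sig.Term Γ (m, j) :=
  Nat.leRec (motive := fun j _ => sig.Term Γ (m, i) → sig.Term Γ (m, j)) (fun t => t)
    (fun {k} _ f t => tIdn m k (f t)) h

end Terms

/-- The equations stating that two cells are parallel. -/
def parallelEqns : ∀ k : ℕ, List (sig.Equation fun _ : Fin 2 => ((1, k) : Fin 3 × ℕ))
  | 0 => []
  | k + 1 =>
    [⟨(1, k), tDom 1 k (.var 0), tDom 1 k (.var 1)⟩, ⟨(1, k), tCod 1 k (.var 0), tCod 1 k (.var 1)⟩]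

/-- The equations defining the domain of an operation symbol. -/
def defEqns : ∀ f : OpSym, List (sig.Equation (sig.dom f))
  | .comp m i _ h =>
    [⟨(m, i), tCodTo m h.le (.var (0 : Fin 2)), tDomTo m h.le (.var (1 : Fin 2))⟩]
  | .bridge k => ⟨(2, k), tKappa k (.var (0 : Fin 2)), tKappa k (.var (1 : Fin 2))⟩ ::
    parallelEqns k
  | _ => []

/-- Names for the axioms of the theory of weak omega categories. -/
inductive Ax : Type
  | dom_dom (m : Fin 3) (k : ℕ)
  | cod_dom (m : Fin 3) (k : ℕ)
  | dom_idn (m : Fin 3) (k : ℕ)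
  | cod_idn (m : Fin 3) (k : ℕ)
  | dom_comp (m : Fin 3) (i : ℕ)
  | cod_comp (m : Fin 3) (i : ℕ)
  | dom_comp_lower (m : Fin 3) (i j : ℕ) (h : i < j)
  | cod_comp_lower (m : Fin 3) (i j : ℕ) (h : i < j)
  | assoc (i j : ℕ) (h : i < j)
  | interchange (i j k : ℕ) (h : i < j) (h' : j < k)
  | id_comp (i j : ℕ) (h : i < j)
  | comp_id (i j : ℕ) (h : i < j)
  | id_interchange (i j : ℕ) (h : i < j)
  | lam_dom (k : ℕ)
  | lam_cod (k : ℕ)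
  | lam_idn (k : ℕ)
  | lam_comp (i j : ℕ) (h : i < j)
  | kappa_dom (k : ℕ)
  | kappa_cod (k : ℕ)
  | kappa_idn (k : ℕ)
  | kappa_comp (i j : ℕ) (h : i < j)
  | rho_dom (k : ℕ)
  | rho_cod (k : ℕ)
  | rho_idn (k : ℕ)
  | lam_rho (k : ℕ)
  | dom_bridge (k : ℕ)
  | cod_bridge (k : ℕ)
  | bridge_refl (k : ℕ)
  | kappa_bridge (k : ℕ)

/-- An equation in `n` variables of a single sort. -/
def mkEqn (n : ℕ) (m : Fin 3) (k : ℕ) (m' : Fin 3) (k' : ℕ)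
    (l r : sig.Term (fun _ : Fin n => ((m, k) : Fin 3 × ℕ)) (m', k')) :
    Σ (n : ℕ) (Γ : Fin n → sig.Sorts), sig.Equation Γ :=
  ⟨n, fun _ => (m, k), (m', k'), l, r⟩

/-- The equation expressing an axiom. -/
def Ax.eqn : Ax → Σ (n : ℕ) (Γ : Fin n → sig.Sorts), sig.Equation Γ
  | .dom_dom m k => mkEqn 1 m (k + 2) m k
      (tDom m k (tDom m (k + 1) (.var 0)))
      (tDom m k (tCod m (k + 1) (.var 0)))
  | .cod_dom m k => mkEqn 1 m (k + 2) m k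
      (tCod m k (tDom m (k + 1) (.var 0)))
      (tCod m k (tCod m (k + 1) (.var 0)))
  | .dom_idn m k => mkEqn 1 m k m k
      (tDom m k (tIdn m k (.var 0)))
      (.var 0)
  | .cod_idn m k => mkEqn 1 m k m k
      (tCod m k (tIdn m k (.var 0)))
      (.var 0)
  | .dom_comp m i => mkEqn 2 m (i + 1) m i
      (tDom m i (tComp m i (i + 1) i.lt_succ_self (.var 0) (.var 1)))
      (tDom m i (.var 0))
  | .cod_comp m i => mkEqn 2 m (i + 1) m i
      (tCod m i (tComp m i (i + 1) i.lt_succ_self (.var 0) (.var 1)))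
      (tCod m i (.var 1))
  | .dom_comp_lower m i j h => mkEqn 2 m (j + 1) m j
      (tDom m j (tComp m i (j + 1) (h.trans j.lt_succ_self) (.var 0) (.var 1)))
      (tComp m i j h (tDom m j (.var 0)) (tDom m j (.var 1)))
  | .cod_comp_lower m i j h => mkEqn 2 m (j + 1) m j
      (tCod m j (tComp m i (j + 1) (h.trans j.lt_succ_self) (.var 0) (.var 1)))
      (tComp m i j h (tCod m j (.var 0)) (tCod m j (.var 1)))
  | .assoc i j h => mkEqn 3 2 j 2 j
      (tComp 2 i j h (tComp 2 i j h (.var 0) (.var 1)) (.var 2))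
      (tComp 2 i j h (.var 0) (tComp 2 i j h (.var 1) (.var 2)))
  | .interchange i j k h h' => mkEqn 4 2 k 2 k
      (tComp 2 i k (h.trans h') (tComp 2 j k h' (.var 0) (.var 1))
        (tComp 2 j k h' (.var 2) (.var 3)))
      (tComp 2 j k h' (tComp 2 i k (h.trans h') (.var 0) (.var 2))
        (tComp 2 i k (h.trans h') (.var 1) (.var 3)))
  | .id_comp i j h => mkEqn 1 2 j 2 j
      (tComp 2 i j h (tIdTo 2 h.le (tDomTo 2 h.le (.var 0))) (.var 0))
      (.var 0)
  | .comp_id i j h => mkEqn 1 2 j 2 j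
      (tComp 2 i j h (.var 0) (tIdTo 2 h.le (tCodTo 2 h.le (.var 0))))
      (.var 0)
  | .id_interchange i j h => mkEqn 2 2 j 2 (j + 1)
      (tComp 2 i (j + 1) (h.trans j.lt_succ_self) (tIdn 2 j (.var 0)) (tIdn 2 j (.var 1)))
      (tIdn 2 j (tComp 2 i j h (.var 0) (.var 1)))
  | .lam_dom k => mkEqn 1 1 (k + 1) 0 k
      (tLam k (tDom 1 k (.var 0)))
      (tDom 0 k (tLam (k + 1) (.var 0)))
  | .lam_cod k => mkEqn 1 1 (k + 1) 0 k
      (tLam k (tCod 1 k (.var 0)))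
      (tCod 0 k (tLam (k + 1) (.var 0)))
  | .lam_idn k => mkEqn 1 1 k 0 (k + 1)
      (tLam (k + 1) (tIdn 1 k (.var 0)))
      (tIdn 0 k (tLam k (.var 0)))
  | .lam_comp i j h => mkEqn 2 1 j 0 j
      (tLam j (tComp 1 i j h (.var 0) (.var 1)))
      (tComp 0 i j h (tLam j (.var 0)) (tLam j (.var 1)))
  | .kappa_dom k => mkEqn 1 1 (k + 1) 2 k
      (tKappa k (tDom 1 k (.var 0)))
      (tDom 2 k (tKappa (k + 1) (.var 0)))
  | .kappa_cod k => mkEqn 1 1 (k + 1) 2 k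
      (tKappa k (tCod 1 k (.var 0)))
      (tCod 2 k (tKappa (k + 1) (.var 0)))
  | .kappa_idn k => mkEqn 1 1 k 2 (k + 1)
      (tKappa (k + 1) (tIdn 1 k (.var 0)))
      (tIdn 2 k (tKappa k (.var 0)))
  | .kappa_comp i j h => mkEqn 2 1 j 2 j
      (tKappa j (tComp 1 i j h (.var 0) (.var 1)))
      (tComp 2 i j h (tKappa j (.var 0)) (tKappa j (.var 1)))
  | .rho_dom k => mkEqn 1 0 (k + 1) 1 k
      (tRho k (tDom 0 k (.var 0)))
      (tDom 1 k (tRho (k + 1) (.var 0)))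
  | .rho_cod k => mkEqn 1 0 (k + 1) 1 k
      (tRho k (tCod 0 k (.var 0)))
      (tCod 1 k (tRho (k + 1) (.var 0)))
  | .rho_idn k => mkEqn 1 0 k 1 (k + 1)
      (tRho (k + 1) (tIdn 0 k (.var 0)))
      (tIdn 1 k (tRho k (.var 0)))
  | .lam_rho k => mkEqn 1 0 k 0 k
      (tLam k (tRho k (.var 0)))
      (.var 0)
  | .dom_bridge k => mkEqn 2 1 k 1 k
      (tDom 1 k (tBridge k (.var 0) (.var 1)))
      (.var 0)
  | .cod_bridge k => mkEqn 2 1 k 1 k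
      (tCod 1 k (tBridge k (.var 0) (.var 1)))
      (.var 1)
  | .bridge_refl k => mkEqn 1 1 k 1 (k + 1)
      (tBridge k (.var 0) (.var 0))
      (tIdn 1 k (.var 0))
  | .kappa_bridge k => mkEqn 2 1 k 2 (k + 1)
      (tKappa (k + 1) (tBridge k (.var 0) (.var 1)))
      (tIdn 2 k (tKappa k (.var 0)))

section UsesOnly

variable {n : ℕ} {Γ : Fin n → sig.Sorts}

theorem usesOnly_tDomTo (m : Fin 3) {i j : ℕ} (h : i ≤ j) (t : sig.Term Γ (m, j))
    (ht : t.UsesOnly {f : sig.Op | OpSym.IsTotal f}) :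
    (tDomTo m h t).UsesOnly {f : sig.Op | OpSym.IsTotal f} := by
  induction h with
  | refl => simpa [tDomTo, Nat.leRec_self] using ht
  | step h ih =>
    unfold tDomTo
    rw [Nat.leRec_succ _ _ h]
    exact ih _ ⟨trivial, fun _ => ht⟩

theorem usesOnly_tCodTo (m : Fin 3) {i j : ℕ} (h : i ≤ j) (t : sig.Term Γ (m, j))
    (ht : t.UsesOnly {f : sig.Op | OpSym.IsTotal f}) :
    (tCodTo m h t).UsesOnly {f : sig.Op | OpSym.IsTotal f} := by
  induction h with
  | refl => simpa [tCodTo, Nat.leRec_self] using ht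
  | step h ih =>
    unfold tCodTo
    rw [Nat.leRec_succ _ _ h]
    exact ih _ ⟨trivial, fun _ => ht⟩

end UsesOnly

/-- The essentially algebraic theory of weak omega categories. -/
def theory : EssAlgTheory where
  toFinSignature := sig
  total := {f : sig.Op | OpSym.IsTotal f}
  defEqns f _ := defEqns f
  defEqns_total := by
    rintro (_ | _ | _ | _ | _ | _ | ⟨m, i, j, h⟩ | k) hf e he
    all_goals try exact absurd trivial hf
    · obtain rfl := List.mem_singleton.1 he
      exact ⟨usesOnly_tCodTo _ _ _ trivial, usesOnly_tDomTo _ _ _ trivial⟩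
    · rcases List.mem_cons.1 he with rfl | he
      · exact ⟨⟨trivial, fun _ => trivial⟩, ⟨trivial, fun _ => trivial⟩⟩
      · cases k with
        | zero => exact absurd he List.not_mem_nil
        | succ k =>
          rcases List.mem_cons.1 he with rfl | he
          · exact ⟨⟨trivial, fun _ => trivial⟩, ⟨trivial, fun _ => trivial⟩⟩
          · obtain rfl := List.mem_singleton.1 he
            exact ⟨⟨trivial, fun _ => trivial⟩, ⟨trivial, fun _ => trivial⟩⟩
  eqns := Set.range Ax.eqn

end OmegaTheory

/-! ### Operations on cells, and the values of terms -/

namespace OmegaTheory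

/-- The data of a partial algebra for the signature of weak omega categories in which the total
operations are everywhere defined. -/
structure Raw : Type (u + 1) where
  cell : Fin 3 → ℕ → Type u
  dom : ∀ m n, cell m (n + 1) → cell m n
  cod : ∀ m n, cell m (n + 1) → cell m n
  idn : ∀ m n, cell m n → cell m (n + 1)
  lam : ∀ n, cell 1 n → cell 0 n
  rho : ∀ n, cell 0 n → cell 1 n
  kappa : ∀ n, cell 1 n → cell 2 n
  comp : ∀ m (i j : ℕ), i < j → cell m j → cell m j → cell m j → Prop
  comp_unique : ∀ m (i j : ℕ) (h : i < j) (a b c d : cell m j),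
    comp m i j h a b c → comp m i j h a b d → c = d
  bridge : ∀ n, cell 1 n → cell 1 n → cell 1 (n + 1) → Prop
  bridge_unique : ∀ n a b c d, bridge n a b c → bridge n a b d → c = d

namespace Raw

variable (D : Raw.{u})

/-- The iterated domain. -/
def domTo (m : Fin 3) {i j : ℕ} (h : i ≤ j) : D.cell m j → D.cell m i :=
  Nat.leRec (motive := fun j _ => D.cell m j → D.cell m i) (fun x => x)
    (fun {k} _ f x => f (D.dom m k x)) h

/-- The iterated codomain. -/
def codTo (m : Fin 3) {i j : ℕ} (h : i ≤ j) : D.cell m j → D.cell m i :=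
  Nat.leRec (motive := fun j _ => D.cell m j → D.cell m i) (fun x => x)
    (fun {k} _ f x => f (D.cod m k x)) h

/-- The iterated identity. -/
def idTo (m : Fin 3) {i j : ℕ} (h : i ≤ j) : D.cell m i → D.cell m j :=
  Nat.leRec (motive := fun j _ => D.cell m i → D.cell m j) (fun x => x)
    (fun {k} _ f x => D.idn m k (f x)) h

/-- The carrier of a sort. -/
abbrev carrier (s : sig.Sorts) : Type u := D.cell s.1 s.2

/-- The graphs of the operations. -/
def graph : ∀ f : OpSym, (Fin f.arity → D.carrier f.src) → D.carrier f.tgt → Prop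
  | .dom m n, x, a => D.dom m n (x (0 : Fin 1)) = a
  | .cod m n, x, a => D.cod m n (x (0 : Fin 1)) = a
  | .idn m n, x, a => D.idn m n (x (0 : Fin 1)) = a
  | .lam n, x, a => D.lam n (x (0 : Fin 1)) = a
  | .rho n, x, a => D.rho n (x (0 : Fin 1)) = a
  | .kappa n, x, a => D.kappa n (x (0 : Fin 1)) = a
  | .comp m i j h, x, a => D.comp m i j h (x (0 : Fin 2)) (x (1 : Fin 2)) a
  | .bridge n, x, a => D.bridge n (x (0 : Fin 2)) (x (1 : Fin 2)) a

theorem graph_unique : ∀ (f : OpSym) (x : Fin f.arity → D.carrier f.src) (a b : D.carrier f.tgt),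
    D.graph f x a → D.graph f x b → a = b
  | .dom _ _, _, _, _, ha, hb => ha.symm.trans hb
  | .cod _ _, _, _, _, ha, hb => ha.symm.trans hb
  | .idn _ _, _, _, _, ha, hb => ha.symm.trans hb
  | .lam _, _, _, _, ha, hb => ha.symm.trans hb
  | .rho _, _, _, _, ha, hb => ha.symm.trans hb
  | .kappa _, _, _, _, ha, hb => ha.symm.trans hb
  | .comp m i j h, _, _, _, ha, hb => D.comp_unique m i j h _ _ _ _ ha hb
  | .bridge n, _, _, _, ha, hb => D.bridge_unique n _ _ _ _ ha hb

/-- The partial algebra given by the data. -/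
noncomputable def alg : PartialAlgebra.{u} sig :=
  PartialAlgebra.ofGraph (S := sig) D.carrier D.graph

theorem mem_op {f : OpSym} {x : Fin f.arity → D.carrier f.src} {a : D.carrier f.tgt} :
    a ∈ D.alg.op f x ↔ D.graph f x a :=
  PartialAlgebra.mem_op_ofGraph (S := sig) D.graph_unique

section Denotes

variable {n : ℕ} {Γ : Fin n → sig.Sorts} (v : ∀ i, D.carrier (Γ i))

/-- The value of a term, at a sort given by a magma and a dimension. -/
def Den {m : Fin 3} {k : ℕ} (t : sig.Term Γ (m, k)) (a : D.cell m k) : Prop :=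
  D.alg.Denotes v t a

variable {v}

theorem den_dom {m : Fin 3} {k : ℕ} {t : sig.Term Γ (m, k + 1)} {a : D.cell m k} :
    D.Den v (tDom m k t) a ↔ ∃ b, D.Den v t b ∧ D.dom m k b = a :=
  ⟨fun ⟨b, hb, ha⟩ => ⟨b (0 : Fin 1), hb (0 : Fin 1), (D.mem_op (f := .dom m k)).1 ha⟩,
    fun ⟨b, hb, ha⟩ => ⟨fun _ => b, fun _ => hb, (D.mem_op (f := .dom m k)).2 ha⟩⟩

theorem den_cod {m : Fin 3} {k : ℕ} {t : sig.Term Γ (m, k + 1)} {a : D.cell m k} :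
    D.Den v (tCod m k t) a ↔ ∃ b, D.Den v t b ∧ D.cod m k b = a :=
  ⟨fun ⟨b, hb, ha⟩ => ⟨b (0 : Fin 1), hb (0 : Fin 1), (D.mem_op (f := .cod m k)).1 ha⟩,
    fun ⟨b, hb, ha⟩ => ⟨fun _ => b, fun _ => hb, (D.mem_op (f := .cod m k)).2 ha⟩⟩

theorem den_idn {m : Fin 3} {k : ℕ} {t : sig.Term Γ (m, k)} {a : D.cell m (k + 1)} :
    D.Den v (tIdn m k t) a ↔ ∃ b, D.Den v t b ∧ D.idn m k b = a :=
  ⟨fun ⟨b, hb, ha⟩ => ⟨b (0 : Fin 1), hb (0 : Fin 1), (D.mem_op (f := .idn m k)).1 ha⟩,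
    fun ⟨b, hb, ha⟩ => ⟨fun _ => b, fun _ => hb, (D.mem_op (f := .idn m k)).2 ha⟩⟩

theorem den_lam {k : ℕ} {t : sig.Term Γ (1, k)} {a : D.cell 0 k} :
    D.Den v (tLam k t) a ↔ ∃ b, D.Den v t b ∧ D.lam k b = a :=
  ⟨fun ⟨b, hb, ha⟩ => ⟨b (0 : Fin 1), hb (0 : Fin 1), (D.mem_op (f := .lam k)).1 ha⟩,
    fun ⟨b, hb, ha⟩ => ⟨fun _ => b, fun _ => hb, (D.mem_op (f := .lam k)).2 ha⟩⟩

theorem den_rho {k : ℕ} {t : sig.Term Γ (0, k)} {a : D.cell 1 k} :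
    D.Den v (tRho k t) a ↔ ∃ b, D.Den v t b ∧ D.rho k b = a :=
  ⟨fun ⟨b, hb, ha⟩ => ⟨b (0 : Fin 1), hb (0 : Fin 1), (D.mem_op (f := .rho k)).1 ha⟩,
    fun ⟨b, hb, ha⟩ => ⟨fun _ => b, fun _ => hb, (D.mem_op (f := .rho k)).2 ha⟩⟩

theorem den_kappa {k : ℕ} {t : sig.Term Γ (1, k)} {a : D.cell 2 k} :
    D.Den v (tKappa k t) a ↔ ∃ b, D.Den v t b ∧ D.kappa k b = a :=
  ⟨fun ⟨b, hb, ha⟩ => ⟨b (0 : Fin 1), hb (0 : Fin 1), (D.mem_op (f := .kappa k)).1 ha⟩,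
    fun ⟨b, hb, ha⟩ => ⟨fun _ => b, fun _ => hb, (D.mem_op (f := .kappa k)).2 ha⟩⟩

theorem den_comp {m : Fin 3} {i j : ℕ} {h : i < j} {t t' : sig.Term Γ (m, j)} {a : D.cell m j} :
    D.Den v (tComp m i j h t t') a ↔
      ∃ b c, D.Den v t b ∧ D.Den v t' c ∧ D.comp m i j h b c a := by
  constructor
  · rintro ⟨b, hb, ha⟩
    exact ⟨b (0 : Fin 2), b (1 : Fin 2), hb (0 : Fin 2), hb (1 : Fin 2), D.mem_op.1 ha⟩
  · rintro ⟨b, c, hb, hc, ha⟩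
    refine ⟨(![b, c] : Fin 2 → D.cell m j), fun k => ?_, D.mem_op.2 ha⟩
    change Fin 2 at k
    fin_cases k
    exacts [hb, hc]

theorem den_bridge {k : ℕ} {t t' : sig.Term Γ (1, k)} {a : D.cell 1 (k + 1)} :
    D.Den v (tBridge k t t') a ↔ ∃ b c, D.Den v t b ∧ D.Den v t' c ∧ D.bridge k b c a := by
  constructor
  · rintro ⟨b, hb, ha⟩
    exact ⟨b (0 : Fin 2), b (1 : Fin 2), hb (0 : Fin 2), hb (1 : Fin 2), D.mem_op.1 ha⟩
  · rintro ⟨b, c, hb, hc, ha⟩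
    refine ⟨(![b, c] : Fin 2 → D.cell 1 k), fun i => ?_, D.mem_op.2 ha⟩
    change Fin 2 at i
    fin_cases i
    exacts [hb, hc]

theorem den_domTo {m : Fin 3} {i j : ℕ} {h : i ≤ j} {t : sig.Term Γ (m, j)} {a : D.cell m i} :
    D.Den v (tDomTo m h t) a ↔ ∃ b, D.Den v t b ∧ D.domTo m h b = a := by
  induction h with
  | refl => simp [tDomTo, domTo, Nat.leRec_self]
  | step h ih =>
    unfold tDomTo domTo
    rw [Nat.leRec_succ _ _ h, Nat.leRec_succ _ _ h]
    refine ih.trans ?_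
    simp only [den_dom]
    constructor
    · rintro ⟨b, ⟨c, hc, rfl⟩, hb⟩
      exact ⟨c, hc, hb⟩
    · rintro ⟨c, hc, hb⟩
      exact ⟨_, ⟨c, hc, rfl⟩, hb⟩

theorem den_codTo {m : Fin 3} {i j : ℕ} {h : i ≤ j} {t : sig.Term Γ (m, j)} {a : D.cell m i} :
    D.Den v (tCodTo m h t) a ↔ ∃ b, D.Den v t b ∧ D.codTo m h b = a := by
  induction h with
  | refl => simp [tCodTo, codTo, Nat.leRec_self]
  | step h ih =>
    unfold tCodTo codTo
    rw [Nat.leRec_succ _ _ h, Nat.leRec_succ _ _ h]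
    refine ih.trans ?_
    simp only [den_cod]
    constructor
    · rintro ⟨b, ⟨c, hc, rfl⟩, hb⟩
      exact ⟨c, hc, hb⟩
    · rintro ⟨c, hc, hb⟩
      exact ⟨_, ⟨c, hc, rfl⟩, hb⟩

theorem den_idTo {m : Fin 3} {i j : ℕ} {h : i ≤ j} {t : sig.Term Γ (m, i)} {a : D.cell m j} :
    D.Den v (tIdTo m h t) a ↔ ∃ b, D.Den v t b ∧ D.idTo m h b = a := by
  induction h with
  | refl => simp [tIdTo, idTo, Nat.leRec_self]
  | step h ih =>
    unfold tIdTo idTo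
    rw [Nat.leRec_succ _ _ h, Nat.leRec_succ _ _ h]
    refine (D.den_idn).trans ?_
    constructor
    · rintro ⟨b, hb, rfl⟩
      obtain ⟨c, hc, rfl⟩ := ih.1 hb
      exact ⟨c, hc, rfl⟩
    · rintro ⟨c, hc, rfl⟩
      exact ⟨_, ih.2 ⟨c, hc, rfl⟩, rfl⟩

end Denotes

/-- The equation `e` holds in the algebra whenever both of its sides are defined. -/
def Holds (e : Σ (n : ℕ) (Γ : Fin n → sig.Sorts), sig.Equation Γ) : Prop :=
  ∀ (v : ∀ i, D.carrier (e.2.1 i)) (a b : D.carrier e.2.2.sort),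
    D.alg.Denotes v e.2.2.lhs a → D.alg.Denotes v e.2.2.rhs b → a = b

/-- True by definition; it replaces projected sorts by explicit pairs, to which the rules for `Den`
apply. -/
theorem holds_mkEqn {n : ℕ} {m : Fin 3} {k : ℕ} {m' : Fin 3} {k' : ℕ}
    {l r : sig.Term (fun _ : Fin n => ((m, k) : Fin 3 × ℕ)) (m', k')} :
    D.Holds (mkEqn n m k m' k' l r) ↔ ∀ (v : Fin n → D.cell m k) (a b : D.cell m' k'),
      D.Den (Γ := fun _ => ((m, k) : Fin 3 × ℕ)) v l a →
        D.Den (Γ := fun _ => ((m, k) : Fin 3 × ℕ)) v r b → a = b :=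
  Iff.rfl

end Raw

/-! ### Rules computing the values of terms -/

namespace Raw.Den

variable {D : Raw.{u}} {n : ℕ} {Γ : Fin n → sig.Sorts} {v : ∀ i, D.carrier (Γ i)}

theorem unique {m : Fin 3} {k : ℕ} {t : sig.Term Γ (m, k)} {a b : D.cell m k}
    (ha : D.Den v t a) (hb : D.Den v t b) : a = b :=
  PartialAlgebra.Denotes.unique D.alg t ha hb

theorem var {m : Fin 3} {k : ℕ} {v : Fin n → D.cell m k} (i : Fin n) :
    D.Den (Γ := fun _ => ((m, k) : Fin 3 × ℕ)) v (.var i) (v i) := rfl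

theorem dom {m : Fin 3} {k : ℕ} {t : sig.Term Γ (m, k + 1)} {a : D.cell m (k + 1)}
    (h : D.Den v t a) : D.Den v (tDom m k t) (D.dom m k a) :=
  D.den_dom.2 ⟨a, h, rfl⟩

theorem cod {m : Fin 3} {k : ℕ} {t : sig.Term Γ (m, k + 1)} {a : D.cell m (k + 1)}
    (h : D.Den v t a) : D.Den v (tCod m k t) (D.cod m k a) :=
  D.den_cod.2 ⟨a, h, rfl⟩

theorem idn {m : Fin 3} {k : ℕ} {t : sig.Term Γ (m, k)} {a : D.cell m k}
    (h : D.Den v t a) : D.Den v (tIdn m k t) (D.idn m k a) :=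
  D.den_idn.2 ⟨a, h, rfl⟩

theorem lam {k : ℕ} {t : sig.Term Γ (1, k)} {a : D.cell 1 k}
    (h : D.Den v t a) : D.Den v (tLam k t) (D.lam k a) :=
  D.den_lam.2 ⟨a, h, rfl⟩

theorem rho {k : ℕ} {t : sig.Term Γ (0, k)} {a : D.cell 0 k}
    (h : D.Den v t a) : D.Den v (tRho k t) (D.rho k a) :=
  D.den_rho.2 ⟨a, h, rfl⟩

theorem kappa {k : ℕ} {t : sig.Term Γ (1, k)} {a : D.cell 1 k}
    (h : D.Den v t a) : D.Den v (tKappa k t) (D.kappa k a) :=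
  D.den_kappa.2 ⟨a, h, rfl⟩

theorem comp {m : Fin 3} {i j : ℕ} {hij : i < j} {t t' : sig.Term Γ (m, j)}
    {a b c : D.cell m j} (h : D.Den v t a) (h' : D.Den v t' b) (hc : D.comp m i j hij a b c) :
    D.Den v (tComp m i j hij t t') c :=
  D.den_comp.2 ⟨a, b, h, h', hc⟩

theorem bridge {k : ℕ} {t t' : sig.Term Γ (1, k)} {a b : D.cell 1 k} {c : D.cell 1 (k + 1)}
    (h : D.Den v t a) (h' : D.Den v t' b) (hc : D.bridge k a b c) :
    D.Den v (tBridge k t t') c :=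
  D.den_bridge.2 ⟨a, b, h, h', hc⟩

theorem domTo {m : Fin 3} {i j : ℕ} {hij : i ≤ j} {t : sig.Term Γ (m, j)} {a : D.cell m j}
    (h : D.Den v t a) : D.Den v (tDomTo m hij t) (D.domTo m hij a) :=
  D.den_domTo.2 ⟨a, h, rfl⟩

theorem codTo {m : Fin 3} {i j : ℕ} {hij : i ≤ j} {t : sig.Term Γ (m, j)} {a : D.cell m j}
    (h : D.Den v t a) : D.Den v (tCodTo m hij t) (D.codTo m hij a) :=
  D.den_codTo.2 ⟨a, h, rfl⟩

theorem idTo {m : Fin 3} {i j : ℕ} {hij : i ≤ j} {t : sig.Term Γ (m, i)} {a : D.cell m i}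
    (h : D.Den v t a) : D.Den v (tIdTo m hij t) (D.idTo m hij a) :=
  D.den_idTo.2 ⟨a, h, rfl⟩

end Raw.Den

end OmegaTheory

/-! ### The axioms and domains of definition in terms of cells -/

namespace OmegaTheory

namespace Raw

variable (D : Raw.{u})

/-- The pattern for axioms without partial operations: both sides have values given by the `Den`
rules, and by uniqueness there are no others. -/
theorem holds_dom_dom_iff (m : Fin 3) (k : ℕ) : D.Holds (Ax.dom_dom m k).eqn ↔
    ∀ x, D.dom m k (D.dom m (k + 1) x) = D.dom m k (D.cod m (k + 1) x) := by
  refine D.holds_mkEqn.trans ⟨fun h x => ?_, fun h v a b ha hb => ?_⟩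
  · exact h (fun _ => x) _ _ (Den.var 0).dom.dom (Den.var 0).cod.dom
  · exact (ha.unique (Den.var 0).dom.dom).trans ((h _).trans (hb.unique (Den.var 0).cod.dom).symm)

theorem holds_cod_dom_iff (m : Fin 3) (k : ℕ) : D.Holds (Ax.cod_dom m k).eqn ↔
    ∀ x, D.cod m k (D.dom m (k + 1) x) = D.cod m k (D.cod m (k + 1) x) := by
  refine D.holds_mkEqn.trans ⟨fun h x => ?_, fun h v a b ha hb => ?_⟩
  · exact h (fun _ => x) _ _ (Den.var 0).dom.cod (Den.var 0).cod.cod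
  · exact (ha.unique (Den.var 0).dom.cod).trans ((h _).trans (hb.unique (Den.var 0).cod.cod).symm)

theorem holds_dom_idn_iff (m : Fin 3) (k : ℕ) : D.Holds (Ax.dom_idn m k).eqn ↔
    ∀ x, D.dom m k (D.idn m k x) = x := by
  refine D.holds_mkEqn.trans ⟨fun h x => ?_, fun h v a b ha hb => ?_⟩
  · exact h (fun _ => x) _ _ (Den.var 0).idn.dom (Den.var 0)
  · exact (ha.unique (Den.var 0).idn.dom).trans ((h _).trans (hb.unique (Den.var 0)).symm)

theorem holds_cod_idn_iff (m : Fin 3) (k : ℕ) : D.Holds (Ax.cod_idn m k).eqn ↔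
    ∀ x, D.cod m k (D.idn m k x) = x := by
  refine D.holds_mkEqn.trans ⟨fun h x => ?_, fun h v a b ha hb => ?_⟩
  · exact h (fun _ => x) _ _ (Den.var 0).idn.cod (Den.var 0)
  · exact (ha.unique (Den.var 0).idn.cod).trans ((h _).trans (hb.unique (Den.var 0)).symm)

theorem holds_lam_dom_iff (k : ℕ) : D.Holds (Ax.lam_dom k).eqn ↔
    ∀ x, D.lam k (D.dom 1 k x) = D.dom 0 k (D.lam (k + 1) x) := by
  refine D.holds_mkEqn.trans ⟨fun h x => ?_, fun h v a b ha hb => ?_⟩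
  · exact h (fun _ => x) _ _ (Den.var 0).dom.lam (Den.var 0).lam.dom
  · exact (ha.unique (Den.var 0).dom.lam).trans ((h _).trans (hb.unique (Den.var 0).lam.dom).symm)

theorem holds_lam_cod_iff (k : ℕ) : D.Holds (Ax.lam_cod k).eqn ↔
    ∀ x, D.lam k (D.cod 1 k x) = D.cod 0 k (D.lam (k + 1) x) := by
  refine D.holds_mkEqn.trans ⟨fun h x => ?_, fun h v a b ha hb => ?_⟩
  · exact h (fun _ => x) _ _ (Den.var 0).cod.lam (Den.var 0).lam.cod
  · exact (ha.unique (Den.var 0).cod.lam).trans ((h _).trans (hb.unique (Den.var 0).lam.cod).symm)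

theorem holds_lam_idn_iff (k : ℕ) : D.Holds (Ax.lam_idn k).eqn ↔
    ∀ x, D.lam (k + 1) (D.idn 1 k x) = D.idn 0 k (D.lam k x) := by
  refine D.holds_mkEqn.trans ⟨fun h x => ?_, fun h v a b ha hb => ?_⟩
  · exact h (fun _ => x) _ _ (Den.var 0).idn.lam (Den.var 0).lam.idn
  · exact (ha.unique (Den.var 0).idn.lam).trans ((h _).trans (hb.unique (Den.var 0).lam.idn).symm)

theorem holds_kappa_dom_iff (k : ℕ) : D.Holds (Ax.kappa_dom k).eqn ↔
    ∀ x, D.kappa k (D.dom 1 k x) = D.dom 2 k (D.kappa (k + 1) x) := by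
  refine D.holds_mkEqn.trans ⟨fun h x => ?_, fun h v a b ha hb => ?_⟩
  · exact h (fun _ => x) _ _ (Den.var 0).dom.kappa (Den.var 0).kappa.dom
  · exact (ha.unique (Den.var 0).dom.kappa).trans ((h _).trans (hb.unique (Den.var 0).kappa.dom).symm)

theorem holds_kappa_cod_iff (k : ℕ) : D.Holds (Ax.kappa_cod k).eqn ↔
    ∀ x, D.kappa k (D.cod 1 k x) = D.cod 2 k (D.kappa (k + 1) x) := by
  refine D.holds_mkEqn.trans ⟨fun h x => ?_, fun h v a b ha hb => ?_⟩
  · exact h (fun _ => x) _ _ (Den.var 0).cod.kappa (Den.var 0).kappa.cod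
  · exact (ha.unique (Den.var 0).cod.kappa).trans ((h _).trans (hb.unique (Den.var 0).kappa.cod).symm)

theorem holds_kappa_idn_iff (k : ℕ) : D.Holds (Ax.kappa_idn k).eqn ↔
    ∀ x, D.kappa (k + 1) (D.idn 1 k x) = D.idn 2 k (D.kappa k x) := by
  refine D.holds_mkEqn.trans ⟨fun h x => ?_, fun h v a b ha hb => ?_⟩
  · exact h (fun _ => x) _ _ (Den.var 0).idn.kappa (Den.var 0).kappa.idn
  · exact (ha.unique (Den.var 0).idn.kappa).trans ((h _).trans (hb.unique (Den.var 0).kappa.idn).symm)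

theorem holds_rho_dom_iff (k : ℕ) : D.Holds (Ax.rho_dom k).eqn ↔
    ∀ x, D.rho k (D.dom 0 k x) = D.dom 1 k (D.rho (k + 1) x) := by
  refine D.holds_mkEqn.trans ⟨fun h x => ?_, fun h v a b ha hb => ?_⟩
  · exact h (fun _ => x) _ _ (Den.var 0).dom.rho (Den.var 0).rho.dom
  · exact (ha.unique (Den.var 0).dom.rho).trans ((h _).trans (hb.unique (Den.var 0).rho.dom).symm)

theorem holds_rho_cod_iff (k : ℕ) : D.Holds (Ax.rho_cod k).eqn ↔
    ∀ x, D.rho k (D.cod 0 k x) = D.cod 1 k (D.rho (k + 1) x) := by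
  refine D.holds_mkEqn.trans ⟨fun h x => ?_, fun h v a b ha hb => ?_⟩
  · exact h (fun _ => x) _ _ (Den.var 0).cod.rho (Den.var 0).rho.cod
  · exact (ha.unique (Den.var 0).cod.rho).trans ((h _).trans (hb.unique (Den.var 0).rho.cod).symm)

theorem holds_rho_idn_iff (k : ℕ) : D.Holds (Ax.rho_idn k).eqn ↔
    ∀ x, D.rho (k + 1) (D.idn 0 k x) = D.idn 1 k (D.rho k x) := by
  refine D.holds_mkEqn.trans ⟨fun h x => ?_, fun h v a b ha hb => ?_⟩
  · exact h (fun _ => x) _ _ (Den.var 0).idn.rho (Den.var 0).rho.idn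
  · exact (ha.unique (Den.var 0).idn.rho).trans ((h _).trans (hb.unique (Den.var 0).rho.idn).symm)

theorem holds_lam_rho_iff (k : ℕ) : D.Holds (Ax.lam_rho k).eqn ↔
    ∀ x, D.lam k (D.rho k x) = x := by
  refine D.holds_mkEqn.trans ⟨fun h x => ?_, fun h v a b ha hb => ?_⟩
  · exact h (fun _ => x) _ _ (Den.var 0).rho.lam (Den.var 0)
  · exact (ha.unique (Den.var 0).rho.lam).trans ((h _).trans (hb.unique (Den.var 0)).symm)

theorem holds_dom_comp_iff (m : Fin 3) (i : ℕ) : D.Holds (Ax.dom_comp m i).eqn ↔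
    ∀ a b c, D.comp m i (i + 1) i.lt_succ_self a b c → D.dom m i c = D.dom m i a := by
  refine D.holds_mkEqn.trans ⟨fun h a b c hc => ?_, fun h v a b ha hb => ?_⟩
  · exact h ![a, b] _ _ ((Den.var 0).comp (Den.var 1) hc).dom (Den.var 0).dom
  · obtain ⟨c, hc, rfl⟩ := D.den_dom.1 ha
    obtain ⟨_, _, rfl, rfl, hc⟩ := D.den_comp.1 hc
    rw [hb.unique (Den.var 0).dom, h _ _ _ hc]

/-- Both sides contain a composite, so the equation is silent unless both exist. The existence of
`d` is therefore a hypothesis here; it is supplied in `toMagma`. -/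
theorem holds_dom_comp_lower_iff (m : Fin 3) (i j : ℕ) (h : i < j) :
    D.Holds (Ax.dom_comp_lower m i j h).eqn ↔
    ∀ a b c d, D.comp m i (j + 1) (h.trans j.lt_succ_self) a b c →
      D.comp m i j h (D.dom m j a) (D.dom m j b) d → D.dom m j c = d := by
  refine D.holds_mkEqn.trans ⟨fun h a b c d hc hd => ?_, fun h v a b ha hb => ?_⟩
  · exact h ![a, b] _ _ ((Den.var 0).comp (Den.var 1) hc).dom
      ((Den.var 0).dom.comp (Den.var 1).dom hd)
  · obtain ⟨c, hc, rfl⟩ := D.den_dom.1 ha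
    obtain ⟨_, _, rfl, rfl, hc⟩ := D.den_comp.1 hc
    obtain ⟨_, _, hx, hy, hd⟩ := D.den_comp.1 hb
    obtain rfl := hx.unique (Den.var 0).dom
    obtain rfl := hy.unique (Den.var 1).dom
    exact h _ _ _ _ hc hd

theorem holds_dom_bridge_iff (k : ℕ) : D.Holds (Ax.dom_bridge k).eqn ↔
    ∀ a b c, D.bridge k a b c → D.dom 1 k c = a := by
  refine D.holds_mkEqn.trans ⟨fun h a b c hc => ?_, fun h v a b ha hb => ?_⟩
  · exact h ![a, b] _ _ ((Den.var 0).bridge (Den.var 1) hc).dom (Den.var 0)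
  · obtain ⟨c, hc, rfl⟩ := D.den_dom.1 ha
    obtain ⟨_, _, rfl, rfl, hc⟩ := D.den_bridge.1 hc
    rw [hb.unique (Den.var 0), h _ _ _ hc]

theorem holds_cod_comp_iff (m : Fin 3) (i : ℕ) : D.Holds (Ax.cod_comp m i).eqn ↔
    ∀ a b c, D.comp m i (i + 1) i.lt_succ_self a b c → D.cod m i c = D.cod m i b := by
  refine D.holds_mkEqn.trans ⟨fun h a b c hc => ?_, fun h v a b ha hb => ?_⟩
  · exact h ![a, b] _ _ ((Den.var 0).comp (Den.var 1) hc).cod (Den.var 1).cod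
  · obtain ⟨c, hc, rfl⟩ := D.den_cod.1 ha
    obtain ⟨_, _, rfl, rfl, hc⟩ := D.den_comp.1 hc
    rw [hb.unique (Den.var 1).cod, h _ _ _ hc]

theorem holds_cod_comp_lower_iff (m : Fin 3) (i j : ℕ) (h : i < j) :
    D.Holds (Ax.cod_comp_lower m i j h).eqn ↔
    ∀ a b c d, D.comp m i (j + 1) (h.trans j.lt_succ_self) a b c →
      D.comp m i j h (D.cod m j a) (D.cod m j b) d → D.cod m j c = d := by
  refine D.holds_mkEqn.trans ⟨fun h a b c d hc hd => ?_, fun h v a b ha hb => ?_⟩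
  · exact h ![a, b] _ _ ((Den.var 0).comp (Den.var 1) hc).cod
      ((Den.var 0).cod.comp (Den.var 1).cod hd)
  · obtain ⟨c, hc, rfl⟩ := D.den_cod.1 ha
    obtain ⟨_, _, rfl, rfl, hc⟩ := D.den_comp.1 hc
    obtain ⟨_, _, hx, hy, hd⟩ := D.den_comp.1 hb
    obtain rfl := hx.unique (Den.var 0).cod
    obtain rfl := hy.unique (Den.var 1).cod
    exact h _ _ _ _ hc hd

theorem holds_cod_bridge_iff (k : ℕ) : D.Holds (Ax.cod_bridge k).eqn ↔
    ∀ a b c, D.bridge k a b c → D.cod 1 k c = b := by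
  refine D.holds_mkEqn.trans ⟨fun h a b c hc => ?_, fun h v a b ha hb => ?_⟩
  · exact h ![a, b] _ _ ((Den.var 0).bridge (Den.var 1) hc).cod (Den.var 1)
  · obtain ⟨c, hc, rfl⟩ := D.den_cod.1 ha
    obtain ⟨_, _, rfl, rfl, hc⟩ := D.den_bridge.1 hc
    rw [hb.unique (Den.var 1), h _ _ _ hc]

theorem holds_lam_comp_iff (i j : ℕ) (h : i < j) :
    D.Holds (Ax.lam_comp i j h).eqn ↔
    ∀ a b c d, D.comp 1 i j h a b c → D.comp 0 i j h (D.lam j a) (D.lam j b) d →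
      D.lam j c = d := by
  refine D.holds_mkEqn.trans ⟨fun h a b c d hc hd => ?_, fun h v a b ha hb => ?_⟩
  · exact h ![a, b] _ _ ((Den.var 0).comp (Den.var 1) hc).lam
      ((Den.var 0).lam.comp (Den.var 1).lam hd)
  · obtain ⟨c, hc, rfl⟩ := D.den_lam.1 ha
    obtain ⟨_, _, rfl, rfl, hc⟩ := D.den_comp.1 hc
    obtain ⟨_, _, hx, hy, hd⟩ := D.den_comp.1 hb
    obtain rfl := hx.unique (Den.var 0).lam
    obtain rfl := hy.unique (Den.var 1).lam
    exact h _ _ _ _ hc hd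

theorem holds_kappa_comp_iff (i j : ℕ) (h : i < j) :
    D.Holds (Ax.kappa_comp i j h).eqn ↔
    ∀ a b c d, D.comp 1 i j h a b c → D.comp 2 i j h (D.kappa j a) (D.kappa j b) d →
      D.kappa j c = d := by
  refine D.holds_mkEqn.trans ⟨fun h a b c d hc hd => ?_, fun h v a b ha hb => ?_⟩
  · exact h ![a, b] _ _ ((Den.var 0).comp (Den.var 1) hc).kappa
      ((Den.var 0).kappa.comp (Den.var 1).kappa hd)
  · obtain ⟨c, hc, rfl⟩ := D.den_kappa.1 ha
    obtain ⟨_, _, rfl, rfl, hc⟩ := D.den_comp.1 hc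
    obtain ⟨_, _, hx, hy, hd⟩ := D.den_comp.1 hb
    obtain rfl := hx.unique (Den.var 0).kappa
    obtain rfl := hy.unique (Den.var 1).kappa
    exact h _ _ _ _ hc hd

theorem holds_bridge_refl_iff (k : ℕ) : D.Holds (Ax.bridge_refl k).eqn ↔
    ∀ a c, D.bridge k a a c → c = D.idn 1 k a := by
  refine D.holds_mkEqn.trans ⟨fun h a c hc => ?_, fun h v a b ha hb => ?_⟩
  · exact h (fun _ => a) _ _ ((Den.var 0).bridge (Den.var 0) hc) (Den.var 0).idn
  · obtain ⟨_, _, rfl, hx, hc⟩ := D.den_bridge.1 ha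
    obtain rfl := hx.unique (Den.var 0)
    rw [hb.unique (Den.var 0).idn, h _ _ hc]

theorem holds_kappa_bridge_iff (k : ℕ) : D.Holds (Ax.kappa_bridge k).eqn ↔
    ∀ a b c, D.bridge k a b c → D.kappa (k + 1) c = D.idn 2 k (D.kappa k a) := by
  refine D.holds_mkEqn.trans ⟨fun h a b c hc => ?_, fun h v a b ha hb => ?_⟩
  · exact h ![a, b] _ _ ((Den.var 0).bridge (Den.var 1) hc).kappa (Den.var 0).kappa.idn
  · obtain ⟨c, hc, rfl⟩ := D.den_kappa.1 ha
    obtain ⟨_, _, rfl, rfl, hc⟩ := D.den_bridge.1 hc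
    rw [hb.unique (Den.var 0).kappa.idn, h _ _ _ hc]

theorem holds_assoc_iff (i j : ℕ) (h : i < j) : D.Holds (Ax.assoc i j h).eqn ↔
    ∀ a b c ab bc l r, D.comp 2 i j h a b ab → D.comp 2 i j h ab c l →
      D.comp 2 i j h b c bc → D.comp 2 i j h a bc r → l = r := by
  refine D.holds_mkEqn.trans
    ⟨fun h a b c ab bc l r hab hl hbc hr => ?_, fun h v l r hl hr => ?_⟩
  · exact h ![a, b, c] _ _ (((Den.var 0).comp (Den.var 1) hab).comp (Den.var 2) hl)
      ((Den.var 0).comp ((Den.var 1).comp (Den.var 2) hbc) hr)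
  · obtain ⟨_, _, hl, rfl, h₁⟩ := D.den_comp.1 hl
    obtain ⟨_, _, rfl, rfl, h₂⟩ := D.den_comp.1 hl
    obtain ⟨_, _, rfl, hr, h₃⟩ := D.den_comp.1 hr
    obtain ⟨_, _, rfl, rfl, h₄⟩ := D.den_comp.1 hr
    exact h _ _ _ _ _ _ _ h₂ h₁ h₄ h₃

theorem holds_interchange_iff (i j k : ℕ) (h : i < j) (h' : j < k) :
    D.Holds (Ax.interchange i j k h h').eqn ↔
    ∀ a b c d ab cd ac bd l r, D.comp 2 j k h' a b ab → D.comp 2 j k h' c d cd →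
      D.comp 2 i k (h.trans h') ab cd l → D.comp 2 i k (h.trans h') a c ac →
      D.comp 2 i k (h.trans h') b d bd → D.comp 2 j k h' ac bd r → l = r := by
  refine D.holds_mkEqn.trans
    ⟨fun h a b c d ab cd ac bd l r hab hcd hl hac hbd hr => ?_, fun h v l r hl hr => ?_⟩
  · exact h ![a, b, c, d] _ _
      (((Den.var 0).comp (Den.var 1) hab).comp ((Den.var 2).comp (Den.var 3) hcd) hl)
      (((Den.var 0).comp (Den.var 2) hac).comp ((Den.var 1).comp (Den.var 3) hbd) hr)
  · obtain ⟨_, _, hab, hcd, h₁⟩ := D.den_comp.1 hl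
    obtain ⟨_, _, rfl, rfl, h₂⟩ := D.den_comp.1 hab
    obtain ⟨_, _, rfl, rfl, h₃⟩ := D.den_comp.1 hcd
    obtain ⟨_, _, hac, hbd, h₄⟩ := D.den_comp.1 hr
    obtain ⟨_, _, rfl, rfl, h₅⟩ := D.den_comp.1 hac
    obtain ⟨_, _, rfl, rfl, h₆⟩ := D.den_comp.1 hbd
    exact h _ _ _ _ _ _ _ _ _ _ h₂ h₃ h₁ h₅ h₆ h₄

/-- Only the value of a composite with an identity is governed by the equation; its existence is
recovered in `isStrict_toMagma`. -/
theorem holds_id_comp_iff (i j : ℕ) (h : i < j) : D.Holds (Ax.id_comp i j h).eqn ↔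
    ∀ a c, D.comp 2 i j h (D.idTo 2 h.le (D.domTo 2 h.le a)) a c → c = a := by
  refine D.holds_mkEqn.trans ⟨fun h a c hc => ?_, fun h v a b ha hb => ?_⟩
  · exact h (fun _ => a) _ _ ((Den.var 0).domTo.idTo.comp (Den.var 0) hc) (Den.var 0)
  · obtain ⟨_, _, hx, rfl, hc⟩ := D.den_comp.1 ha
    obtain rfl := hx.unique (Den.var 0).domTo.idTo
    rw [hb.unique (Den.var 0), h _ _ hc]

theorem holds_comp_id_iff (i j : ℕ) (h : i < j) : D.Holds (Ax.comp_id i j h).eqn ↔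
    ∀ a c, D.comp 2 i j h a (D.idTo 2 h.le (D.codTo 2 h.le a)) c → c = a := by
  refine D.holds_mkEqn.trans ⟨fun h a c hc => ?_, fun h v a b ha hb => ?_⟩
  · exact h (fun _ => a) _ _ ((Den.var 0).comp (Den.var 0).codTo.idTo hc) (Den.var 0)
  · obtain ⟨_, _, rfl, hx, hc⟩ := D.den_comp.1 ha
    obtain rfl := hx.unique (Den.var 0).codTo.idTo
    rw [hb.unique (Den.var 0), h _ _ hc]

theorem holds_id_interchange_iff (i j : ℕ) (h : i < j) :
    D.Holds (Ax.id_interchange i j h).eqn ↔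
    ∀ a b c d, D.comp 2 i (j + 1) (h.trans j.lt_succ_self) (D.idn 2 j a) (D.idn 2 j b) d →
      D.comp 2 i j h a b c → d = D.idn 2 j c := by
  refine D.holds_mkEqn.trans ⟨fun h a b c d hd hc => ?_, fun h v a b ha hb => ?_⟩
  · exact h ![a, b] _ _ ((Den.var 0).idn.comp (Den.var 1).idn hd)
      ((Den.var 0).comp (Den.var 1) hc).idn
  · obtain ⟨_, _, hx, hy, hd⟩ := D.den_comp.1 ha
    obtain rfl := hx.unique (Den.var 0).idn
    obtain rfl := hy.unique (Den.var 1).idn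
    obtain ⟨c, hc, rfl⟩ := D.den_idn.1 hb
    obtain ⟨_, _, rfl, rfl, hc⟩ := D.den_comp.1 hc
    exact h _ _ _ _ hd hc

/-- Parallel cells of the second magma. -/
def Parallel : ∀ {k : ℕ}, D.cell 1 k → D.cell 1 k → Prop
  | 0, _, _ => True
  | k + 1, a, b => D.dom 1 k a = D.dom 1 k b ∧ D.cod 1 k a = D.cod 1 k b

/-- Once both sides of a defining equation are evaluated, having a common value is plain equality of
cells. -/
theorem exists_den_iff {n : ℕ} {Γ : Fin n → sig.Sorts} {v : ∀ i, D.carrier (Γ i)}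
    {m : Fin 3} {k : ℕ} {t t' : sig.Term Γ (m, k)} {a b : D.cell m k} (ha : D.Den v t a)
    (hb : D.Den v t' b) : (∃ c, D.Den v t c ∧ D.Den v t' c) ↔ a = b :=
  ⟨fun ⟨_, hc, hc'⟩ => (ha.unique hc).trans (hc'.unique hb), fun h => ⟨a, ha, h ▸ hb⟩⟩

theorem defined_comp_iff (m : Fin 3) (i j : ℕ) (h : i < j) (x : Fin 2 → D.cell m j) :
    EssAlgTheory.Defined (T := theory) D.alg (.comp m i j h) x ↔
      D.codTo m h.le (x 0) = D.domTo m h.le (x 1) := by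
  refine Iff.trans ?_ (D.exists_den_iff (Γ := fun _ : Fin 2 => ((m, j) : Fin 3 × ℕ)) (v := x)
    (Den.var 0).codTo (Den.var 1).domTo)
  constructor
  · intro hd
    -- `id` proves that the symbol is not total, because its totality predicate reduces to `False`.
    exact hd id _ (List.mem_singleton.2 rfl)
  · intro hd _ e he
    obtain rfl := List.mem_singleton.1 he
    exact hd

theorem defined_bridge_iff (k : ℕ) (x : Fin 2 → D.cell 1 k) :
    EssAlgTheory.Defined (T := theory) D.alg (.bridge k) x ↔
      D.Parallel (x 0) (x 1) ∧ D.kappa k (x 0) = D.kappa k (x 1) := by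
  have hκ := D.exists_den_iff (Γ := fun _ : Fin 2 => ((1, k) : Fin 3 × ℕ)) (v := x)
    (Den.var 0).kappa (Den.var 1).kappa
  -- In dimension zero the parallelism condition contributes no equations.
  cases k with
  | zero =>
    constructor
    · intro hd
      exact ⟨trivial, hκ.1 (hd id _ (List.mem_singleton.2 rfl))⟩
    · intro hd _ e he
      obtain rfl := List.mem_singleton.1 he
      exact hκ.2 hd.2
  | succ k =>
    have h₁ := D.exists_den_iff (Γ := fun _ : Fin 2 => ((1, k + 1) : Fin 3 × ℕ)) (v := x)
      (Den.var 0).dom (Den.var 1).dom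
    have h₂ := D.exists_den_iff (Γ := fun _ : Fin 2 => ((1, k + 1) : Fin 3 × ℕ)) (v := x)
      (Den.var 0).cod (Den.var 1).cod
    constructor
    · intro hd
      exact ⟨⟨h₁.1 (hd id _ (.tail _ (.head _))), h₂.1 (hd id _ (.tail _ (.tail _ (.head _))))⟩,
        hκ.1 (hd id _ (.head _))⟩
    · intro hd _ e he
      rcases List.mem_cons.1 he with rfl | he
      · exact hκ.2 hd.2
      · rcases List.mem_cons.1 he with rfl | he
        · exact h₁.2 hd.1.1
        · obtain rfl := List.mem_singleton.1 he
          exact h₂.2 hd.1.2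

end Raw

end OmegaTheory

/-! ### From weak omega categories to models -/

namespace OmegaTheory

/-- Weak omega categories, with the three magmas in a family. -/
structure Data : Type (u + 1) where
  magma : Fin 3 → OmegaMagma.{u}
  lam : magma 1 ⟶ magma 0
  rho : OmegaMagma.forgetToGraph.obj (magma 0) ⟶ OmegaMagma.forgetToGraph.obj (magma 1)
  split : rho ≫ OmegaMagma.forgetToGraph.map lam = 𝟙 _
  R : BridgeRelation (magma 1).toOmegaGraph
  isStrict : (magma 2).IsStrict
  kappa : magma 1 ⟶ magma 2
  isPenon : IsCategoricalPenon R (BridgeRelation.diagonal (magma 2).toOmegaGraph) kappa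

namespace Data

variable (D : Data.{u})

/-- The operations of a weak omega category. -/
def raw : Raw.{u} where
  cell m := (D.magma m).cell
  dom m := (D.magma m).dom
  cod m := (D.magma m).cod
  idn m := (D.magma m).idn
  lam := D.lam.app
  rho := D.rho.app
  kappa := D.kappa.app
  comp m := (D.magma m).comp
  comp_unique m := (D.magma m).comp_unique
  bridge := D.R.rel
  bridge_unique := D.R.unique

theorem lam_rho (n : ℕ) (x : (D.magma 0).cell n) : D.lam.app n (D.rho.app n x) = x :=
  congrArg (fun φ : OmegaMagma.forgetToGraph.obj (D.magma 0) ⟶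
    OmegaMagma.forgetToGraph.obj (D.magma 0) => OmegaGraph.Hom.app φ n x) D.split

/-- The axioms hold in a weak omega category. -/
theorem holds (e : Ax) : D.raw.Holds e.eqn := by
  cases e with
  | dom_dom m k => exact (Raw.holds_dom_dom_iff _ _ _).2 ((D.magma m).dom_dom k)
  | cod_dom m k => exact (Raw.holds_cod_dom_iff _ _ _).2 ((D.magma m).cod_dom k)
  | dom_idn m k => exact (Raw.holds_dom_idn_iff _ _ _).2 ((D.magma m).dom_idn k)
  | cod_idn m k => exact (Raw.holds_cod_idn_iff _ _ _).2 ((D.magma m).cod_idn k)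
  | dom_comp m i =>
    exact (Raw.holds_dom_comp_iff _ _ _).2 fun a b c h => ((D.magma m).comp_dom_cod i a b c h).1
  | cod_comp m i =>
    exact (Raw.holds_cod_comp_iff _ _ _).2 fun a b c h => ((D.magma m).comp_dom_cod i a b c h).2
  | dom_comp_lower m i j h =>
    -- `comp_lower` exhibits the domain of `c` as a composite of the domains, and composites are
    -- unique.
    exact (Raw.holds_dom_comp_lower_iff _ _ _ _ _).2 fun a b c d hc hd =>
      (D.magma m).comp_unique i j h _ _ _ _ ((D.magma m).comp_lower i j h a b c hc).1 hd
  | cod_comp_lower m i j h =>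
    exact (Raw.holds_cod_comp_lower_iff _ _ _ _ _).2 fun a b c d hc hd =>
      (D.magma m).comp_unique i j h _ _ _ _ ((D.magma m).comp_lower i j h a b c hc).2 hd
  | assoc i j h => exact (Raw.holds_assoc_iff _ _ _ _).2 (D.isStrict.assoc i j h)
  | interchange i j k h h' =>
    exact (Raw.holds_interchange_iff _ _ _ _ _ _).2 (D.isStrict.interchange i j k h h')
  | id_comp i j h =>
    exact (Raw.holds_id_comp_iff _ _ _ _).2 fun a c hc =>
      (D.magma 2).comp_unique i j h _ _ _ _ hc (D.isStrict.id_comp i j h a)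
  | comp_id i j h =>
    exact (Raw.holds_comp_id_iff _ _ _ _).2 fun a c hc =>
      (D.magma 2).comp_unique i j h _ _ _ _ hc (D.isStrict.comp_id i j h a)
  | id_interchange i j h =>
    exact (Raw.holds_id_interchange_iff _ _ _ _).2 fun a b c d hd hc =>
      (D.magma 2).comp_unique i (j + 1) _ _ _ _ _ hd (D.isStrict.id_interchange i j h a b c hc)
  | lam_dom k => exact (Raw.holds_lam_dom_iff _ _).2 (D.lam.app_dom k)
  | lam_cod k => exact (Raw.holds_lam_cod_iff _ _).2 (D.lam.app_cod k)
  | lam_idn k => exact (Raw.holds_lam_idn_iff _ _).2 (D.lam.app_idn k)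
  | lam_comp i j h =>
    exact (Raw.holds_lam_comp_iff _ _ _ _).2 fun a b c d hc hd =>
      (D.magma 0).comp_unique i j h _ _ _ _ (D.lam.app_comp i j h a b c hc) hd
  | kappa_dom k => exact (Raw.holds_kappa_dom_iff _ _).2 (D.kappa.app_dom k)
  | kappa_cod k => exact (Raw.holds_kappa_cod_iff _ _).2 (D.kappa.app_cod k)
  | kappa_idn k => exact (Raw.holds_kappa_idn_iff _ _).2 (D.kappa.app_idn k)
  | kappa_comp i j h =>
    exact (Raw.holds_kappa_comp_iff _ _ _ _).2 fun a b c d hc hd =>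
      (D.magma 2).comp_unique i j h _ _ _ _ (D.kappa.app_comp i j h a b c hc) hd
  | rho_dom k => exact (Raw.holds_rho_dom_iff _ _).2 (D.rho.app_dom k)
  | rho_cod k => exact (Raw.holds_rho_cod_iff _ _).2 (D.rho.app_cod k)
  | rho_idn k => exact (Raw.holds_rho_idn_iff _ _).2 (D.rho.app_idn k)
  | lam_rho k => exact (Raw.holds_lam_rho_iff _ _).2 (D.lam_rho k)
  | dom_bridge k =>
    exact (Raw.holds_dom_bridge_iff _ _).2 fun a b c h => (D.R.parallel k a b c h).2.1
  | cod_bridge k =>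
    exact (Raw.holds_cod_bridge_iff _ _).2 fun a b c h => (D.R.parallel k a b c h).2.2
  | bridge_refl k =>
    exact (Raw.holds_bridge_refl_iff _ _).2 fun a c h => D.R.unique k _ _ _ _ h (D.R.refl k a)
  | kappa_bridge k =>
    exact (Raw.holds_kappa_bridge_iff _ _).2 fun a b c h => (D.isPenon.map_rel k a b c h).2

theorem exists_comp_iff (m : Fin 3) (i j : ℕ) (h : i < j) (a b : D.raw.cell m j) :
    (∃ c, D.raw.comp m i j h a b c) ↔ D.raw.codTo m h.le a = D.raw.domTo m h.le b :=
  ⟨fun ⟨c, hc⟩ => (D.magma m).composable i j h a b c hc, (D.magma m).comp_exists i j h a b⟩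

theorem raw_parallel_iff (k : ℕ) (a b : D.raw.cell 1 k) :
    D.raw.Parallel a b ↔ (D.magma 1).Parallel a b := by
  cases k <;> exact Iff.rfl

/-- The two defining conditions of the bridge symbol come from the bridge relation and from
`map_rel`; the converse is the Penon condition `exists_rel`. -/
theorem exists_bridge_iff (k : ℕ) (a b : D.raw.cell 1 k) :
    (∃ c, D.raw.bridge k a b c) ↔ D.raw.Parallel a b ∧ D.raw.kappa k a = D.raw.kappa k b := by
  rw [raw_parallel_iff]
  exact ⟨fun ⟨c, hc⟩ => ⟨(D.R.parallel k a b c hc).1, (D.isPenon.map_rel k a b c hc).1⟩,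
    fun h => D.isPenon.exists_rel k a b h.1 h.2⟩

/-- The model of the theory given by a weak omega category. -/
noncomputable def model : EssAlgTheory.Model.{u} theory :=
  EssAlgTheory.Model.ofGraph (T := theory) D.raw.carrier D.raw.graph
    (by
      rintro (_ | _ | _ | _ | _ | _ | ⟨m, i, j, h⟩ | k) x
      all_goals try exact ⟨fun _ hf => absurd trivial hf, fun _ => ⟨_, rfl⟩⟩
      · exact (D.exists_comp_iff m i j h _ _).trans (D.raw.defined_comp_iff m i j h x).symm
      · exact (D.exists_bridge_iff k _ _).trans (D.raw.defined_bridge_iff k x).symm)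
    (by
      rintro _ ⟨e, rfl⟩
      exact D.holds e)

theorem mem_op_model {f : OpSym} {x : Fin f.arity → D.raw.carrier f.src}
    {a : D.raw.carrier f.tgt} : a ∈ D.model.op f x ↔ D.raw.graph f x a :=
  D.raw.mem_op

end Data

/-! ### From models to operations on cells -/

namespace Raw

/-- The operations of a model of the theory. -/
noncomputable def ofModel (M : EssAlgTheory.Model.{u} theory) : Raw.{u} where
  cell m n := M.carrier (m, n)
  dom m n x := (M.op (OpSym.dom m n) fun _ => x).get (M.op_total (OpSym.dom m n) trivial _)
  cod m n x := (M.op (OpSym.cod m n) fun _ => x).get (M.op_total (OpSym.cod m n) trivial _)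
  idn m n x := (M.op (OpSym.idn m n) fun _ => x).get (M.op_total (OpSym.idn m n) trivial _)
  lam n x := (M.op (OpSym.lam n) fun _ => x).get (M.op_total (OpSym.lam n) trivial _)
  rho n x := (M.op (OpSym.rho n) fun _ => x).get (M.op_total (OpSym.rho n) trivial _)
  kappa n x := (M.op (OpSym.kappa n) fun _ => x).get (M.op_total (OpSym.kappa n) trivial _)
  comp m i j h a b c := c ∈ M.op (OpSym.comp m i j h) (![a, b] : Fin 2 → M.carrier (m, j))
  comp_unique _ _ _ _ _ _ _ _ h h' := Part.mem_unique h h'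
  bridge n a b c := c ∈ M.op (OpSym.bridge n) (![a, b] : Fin 2 → M.carrier (1, n))
  bridge_unique _ _ _ _ _ h h' := Part.mem_unique h h'

theorem graph_ofModel_iff (M : EssAlgTheory.Model.{u} theory) (f : OpSym)
    (x : Fin f.arity → M.carrier f.src) (a : M.carrier f.tgt) :
    (ofModel M).graph f x a ↔ a ∈ M.op f x := by
  -- `ofModel` rebuilds argument tuples from their entries; these two facts identify the rebuilt
  -- tuples with the original ones.
  have h₁ : ∀ {α : Type u} (x : Fin 1 → α), (fun _ => x 0) = x := fun x =>
    funext fun i => congrArg x (Subsingleton.elim _ _)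
  have h₂ : ∀ {α : Type u} (x : Fin 2 → α), ![x 0, x 1] = x := fun x =>
    funext fun i => by fin_cases i <;> rfl
  cases f with
  | comp m i j h =>
    change a ∈ M.op (OpSym.comp m i j h) ![x (0 : Fin 2), x (1 : Fin 2)] ↔ _
    rw [h₂ x]
  | bridge k =>
    change a ∈ M.op (OpSym.bridge k) ![x (0 : Fin 2), x (1 : Fin 2)] ↔ _
    rw [h₂ x]
  | dom m k =>
    exact (Part.get_eq_iff_mem _).trans
      (iff_of_eq (congrArg (fun y => a ∈ M.op (OpSym.dom m k) y) (h₁ x)))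
  | cod m k =>
    exact (Part.get_eq_iff_mem _).trans
      (iff_of_eq (congrArg (fun y => a ∈ M.op (OpSym.cod m k) y) (h₁ x)))
  | idn m k =>
    exact (Part.get_eq_iff_mem _).trans
      (iff_of_eq (congrArg (fun y => a ∈ M.op (OpSym.idn m k) y) (h₁ x)))
  | lam k =>
    exact (Part.get_eq_iff_mem _).trans
      (iff_of_eq (congrArg (fun y => a ∈ M.op (OpSym.lam k) y) (h₁ x)))
  | rho k =>
    exact (Part.get_eq_iff_mem _).trans
      (iff_of_eq (congrArg (fun y => a ∈ M.op (OpSym.rho k) y) (h₁ x)))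
  | kappa k =>
    exact (Part.get_eq_iff_mem _).trans
      (iff_of_eq (congrArg (fun y => a ∈ M.op (OpSym.kappa k) y) (h₁ x)))

/-- The carriers agree by definition, so only operations are compared. An equality, not just an
isomorphism, is what bijectivity on objects needs. -/
theorem alg_ofModel (M : EssAlgTheory.Model.{u} theory) :
    (ofModel M).alg = M.toPartialAlgebra := by
  have h : (ofModel M).alg.op = M.op := funext fun f => funext fun x => Part.ext fun a =>
    (ofModel M).mem_op.trans (graph_ofModel_iff M f x a)
  exact congrArg (PartialAlgebra.mk (S := sig) M.carrier) h

theorem holds_ofModel (M : EssAlgTheory.Model.{u} theory) (e : Ax) :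
    (ofModel M).Holds e.eqn := by
  unfold Holds carrier
  have h := alg_ofModel M
  -- Valuations depend on the carrier, so the algebra is made a variable before the equality is
  -- eliminated.
  have : ∀ A : PartialAlgebra.{u} sig, A = M.toPartialAlgebra →
      ∀ (v : ∀ i, A.carrier (e.eqn.2.1 i)) (a b : A.carrier e.eqn.2.2.sort),
      A.Denotes v e.eqn.2.2.lhs a → A.Denotes v e.eqn.2.2.rhs b → a = b := by
    rintro _ rfl
    exact M.holds e.eqn ⟨e, rfl⟩
  exact this _ h

theorem exists_graph_ofModel_iff (M : EssAlgTheory.Model.{u} theory) (f : OpSym)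
    (x : Fin f.arity → M.carrier f.src) :
    (∃ a, (ofModel M).graph f x a) ↔
      EssAlgTheory.Defined (T := theory) (ofModel M).alg f x := by
  have : ∀ A : PartialAlgebra.{u} sig, A = M.toPartialAlgebra →
      ∀ x : (∀ k, A.carrier (sig.dom f k)), (A.op f x).Dom ↔
        EssAlgTheory.Defined (T := theory) A f x := by
    rintro _ rfl
    exact M.dom_iff_defined f
  exact this _ (alg_ofModel M) x

end Raw

end OmegaTheory

/-! ### From algebras satisfying the axioms to weak omega categories -/

namespace OmegaTheory

namespace Raw

variable (D : Raw.{u}) (hD : ∀ e : Ax, D.Holds e.eqn)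
  (hcomp : ∀ m i j (h : i < j) (a b : D.cell m j),
    (∃ c, D.comp m i j h a b c) ↔ D.codTo m h.le a = D.domTo m h.le b)
  (hbridge : ∀ k (a b : D.cell 1 k),
    (∃ c, D.bridge k a b c) ↔ D.Parallel a b ∧ D.kappa k a = D.kappa k b)

include hD in
/-- The omega graphs of an algebra satisfying the axioms. -/
def toGraph (m : Fin 3) : OmegaGraph.{u} where
  cell := D.cell m
  dom := D.dom m
  cod := D.cod m
  idn := D.idn m
  dom_dom k := (D.holds_dom_dom_iff m k).1 (hD _)
  cod_dom k := (D.holds_cod_dom_iff m k).1 (hD _)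
  dom_idn k := (D.holds_dom_idn_iff m k).1 (hD _)
  cod_idn k := (D.holds_cod_idn_iff m k).1 (hD _)

include hD hcomp in
/-- The omega magmas of an algebra satisfying the axioms. -/
def toMagma (m : Fin 3) : OmegaMagma.{u} where
  toOmegaGraph := D.toGraph hD m
  comp := D.comp m
  composable i j h a b c hc := (hcomp m i j h a b).1 ⟨c, hc⟩
  comp_unique := D.comp_unique m
  comp_exists i j h a b := (hcomp m i j h a b).2
  comp_dom_cod i a b c hc :=
    ⟨(D.holds_dom_comp_iff m i).1 (hD _) a b c hc, (D.holds_cod_comp_iff m i).1 (hD _) a b c hc⟩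
  comp_lower i j h a b c hc := by
    let X := D.toGraph hD m
    have hab : X.codTo (h.trans j.lt_succ_self).le a = X.domTo (h.trans j.lt_succ_self).le b :=
      (hcomp m i (j + 1) _ a b).1 ⟨c, hc⟩
    -- By globularity this one equation makes both the domains and the codomains of `a` and `b`
    -- composable. The lower composites then exist, and the axioms identify them with the boundaries
    -- of `c`.
    have hab' : X.codTo h.le (X.cod j a) = X.domTo h.le (X.dom j b) :=
      (X.codTo_succ h.le a).symm.trans (hab.trans (X.domTo_succ h.le b))
    obtain ⟨d, hd⟩ := (hcomp m i j h (D.dom m j a) (D.dom m j b)).2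
      ((X.codTo_dom h a).trans hab')
    obtain ⟨e, he⟩ := (hcomp m i j h (D.cod m j a) (D.cod m j b)).2
      (hab'.trans (X.domTo_cod h b).symm)
    obtain rfl := (D.holds_dom_comp_lower_iff m i j h).1 (hD _) a b c d hc hd
    obtain rfl := (D.holds_cod_comp_lower_iff m i j h).1 (hD _) a b c e hc he
    exact ⟨hd, he⟩

/-- The third magma of an algebra satisfying the axioms is a strict omega category. -/
theorem isStrict_toMagma : (D.toMagma hD hcomp 2).IsStrict where
  assoc i j h := (D.holds_assoc_iff i j h).1 (hD _)
  interchange i j k h h' := (D.holds_interchange_iff i j k h h').1 (hD _)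
  id_comp i j h a := by
    -- The iterated codomain of an iterated identity is the original cell, so the composite exists;
    -- the axiom then forces it to be `a`.
    obtain ⟨c, hc⟩ := (D.toMagma hD hcomp 2).comp_exists i j h _ a
      ((D.toMagma hD hcomp 2).codTo_idTo h.le _)
    exact (D.holds_id_comp_iff i j h).1 (hD _) a c hc ▸ hc
  comp_id i j h a := by
    obtain ⟨c, hc⟩ := (D.toMagma hD hcomp 2).comp_exists i j h a _
      ((D.toMagma hD hcomp 2).domTo_idTo h.le _).symm
    exact (D.holds_comp_id_iff i j h).1 (hD _) a c hc ▸ hc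
  id_interchange i j h a b c hc := by
    let X := D.toMagma hD hcomp 2
    obtain ⟨d, hd⟩ := X.comp_exists i (j + 1) (h.trans j.lt_succ_self) (X.idn j a) (X.idn j b)
      ((X.codTo_succ h.le _).trans ((congrArg _ (X.cod_idn j a)).trans
        ((X.composable i j h a b c hc).trans ((congrArg _ (X.dom_idn j b)).symm.trans
          (X.domTo_succ h.le _).symm))))
    obtain rfl := (D.holds_id_interchange_iff i j h).1 (hD _) a b c d hd hc
    exact hd

/-- The coherence morphism of an algebra satisfying the axioms. -/
def toLam : D.toMagma hD hcomp 1 ⟶ D.toMagma hD hcomp 0 :=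
  OmegaMagma.Hom.mk (X := D.toMagma hD hcomp 1) (Y := D.toMagma hD hcomp 0)
    { app := D.lam
      app_dom := fun k => (D.holds_lam_dom_iff k).1 (hD _)
      app_cod := fun k => (D.holds_lam_cod_iff k).1 (hD _)
      app_idn := fun k => (D.holds_lam_idn_iff k).1 (hD _) }
    (fun i j h a b c hc => by
      let X := D.toMagma hD hcomp 1
      let Y := D.toMagma hD hcomp 0
      -- The images are composable because `lam` commutes with iterated boundaries; the axiom then
      -- identifies their composite with the image of `c`.
      obtain ⟨d, hd⟩ := Y.comp_exists i j h (D.lam j a) (D.lam j b)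
        ((GlobularSet.map_codTo (X := X.toGlobularSet) (Y := Y.toGlobularSet) D.lam
          (fun k => (D.holds_lam_cod_iff k).1 (hD _)) h.le a).symm.trans
          ((congrArg _ (X.composable i j h a b c hc)).trans
          (GlobularSet.map_domTo (X := X.toGlobularSet) (Y := Y.toGlobularSet) D.lam
            (fun k => (D.holds_lam_dom_iff k).1 (hD _)) h.le b)))
      obtain rfl := (D.holds_lam_comp_iff i j h).1 (hD _) a b c d hc hd
      exact hd)

/-- The morphism to a strict omega category of an algebra satisfying the axioms. -/
def toKappa : D.toMagma hD hcomp 1 ⟶ D.toMagma hD hcomp 2 :=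
  OmegaMagma.Hom.mk (X := D.toMagma hD hcomp 1) (Y := D.toMagma hD hcomp 2)
    { app := D.kappa
      app_dom := fun k => (D.holds_kappa_dom_iff k).1 (hD _)
      app_cod := fun k => (D.holds_kappa_cod_iff k).1 (hD _)
      app_idn := fun k => (D.holds_kappa_idn_iff k).1 (hD _) }
    (fun i j h a b c hc => by
      let X := D.toMagma hD hcomp 1
      let Y := D.toMagma hD hcomp 2
      obtain ⟨d, hd⟩ := Y.comp_exists i j h (D.kappa j a) (D.kappa j b)
        ((GlobularSet.map_codTo (X := X.toGlobularSet) (Y := Y.toGlobularSet) D.kappa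
          (fun k => (D.holds_kappa_cod_iff k).1 (hD _)) h.le a).symm.trans
          ((congrArg _ (X.composable i j h a b c hc)).trans
          (GlobularSet.map_domTo (X := X.toGlobularSet) (Y := Y.toGlobularSet) D.kappa
            (fun k => (D.holds_kappa_dom_iff k).1 (hD _)) h.le b)))
      obtain rfl := (D.holds_kappa_comp_iff i j h).1 (hD _) a b c d hc hd
      exact hd)

theorem parallel_toGraph_iff (k : ℕ) (a b : D.cell 1 k) :
    D.Parallel a b ↔ (D.toGraph hD 1).Parallel a b := by
  cases k <;> exact Iff.rfl

include hbridge in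
/-- The bridge relation of an algebra satisfying the axioms. -/
def toBridge : BridgeRelation (D.toGraph hD 1) where
  rel := D.bridge
  parallel k a b c h := ⟨(D.parallel_toGraph_iff hD k a b).1 ((hbridge k a b).1 ⟨c, h⟩).1,
    (D.holds_dom_bridge_iff k).1 (hD _) a b c h, (D.holds_cod_bridge_iff k).1 (hD _) a b c h⟩
  refl k a := by
    -- A cell is parallel to itself with the same image, so a bridge exists; the axiom says that it
    -- is the identity.
    obtain ⟨c, hc⟩ := (hbridge k a a).2 ⟨by cases k <;> trivial, rfl⟩
    obtain rfl := (D.holds_bridge_refl_iff k).1 (hD _) a c hc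
    exact hc
  unique := D.bridge_unique

/-- The weak omega category given by an algebra satisfying the axioms. -/
def toData : Data.{u} where
  magma := D.toMagma hD hcomp
  lam := D.toLam hD hcomp
  rho := OmegaGraph.Hom.mk (X := D.toGraph hD 0) (Y := D.toGraph hD 1) D.rho
    (fun k => (D.holds_rho_dom_iff k).1 (hD _)) (fun k => (D.holds_rho_cod_iff k).1 (hD _))
    (fun k => (D.holds_rho_idn_iff k).1 (hD _))
  split := OmegaGraph.Hom.ext (funext fun k => funext fun x =>
    (D.holds_lam_rho_iff k).1 (hD _) x)
  R := D.toBridge hD hbridge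
  isStrict := D.isStrict_toMagma hD hcomp
  kappa := D.toKappa hD hcomp
  isPenon :=
    { isBridgeMorphism := fun k a b c h => ⟨((hbridge k a b).1 ⟨c, h⟩).2,
        (D.holds_kappa_bridge_iff k).1 (hD _) a b c h⟩
      isStrict := D.isStrict_toMagma hD hcomp
      eq_diagonal := rfl
      map_rel := fun k a b c h => ⟨((hbridge k a b).1 ⟨c, h⟩).2,
        (D.holds_kappa_bridge_iff k).1 (hD _) a b c h⟩
      exists_rel := fun k a b h h' =>
        (hbridge k a b).2 ⟨(D.parallel_toGraph_iff hD k a b).2 h, h'⟩ }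

end Raw

theorem Data.exists_model_eq (M : EssAlgTheory.Model.{u} theory) : ∃ D : Data.{u}, D.model = M := by
  refine ⟨(Raw.ofModel M).toData (Raw.holds_ofModel M) (fun m i j h a b => ?_)
    (fun k a b => ?_), ?_⟩
  · exact (Raw.exists_graph_ofModel_iff M (.comp m i j h) ![a, b]).trans
      ((Raw.ofModel M).defined_comp_iff m i j h ![a, b])
  · exact (Raw.exists_graph_ofModel_iff M (.bridge k) ![a, b]).trans
      ((Raw.ofModel M).defined_bridge_iff k ![a, b])
  -- The other fields of a model are propositions, so equality of the partial algebras suffices.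
  · have h : ∀ N N' : EssAlgTheory.Model.{u} theory,
        N.toPartialAlgebra = N'.toPartialAlgebra → N = N' := by
      rintro ⟨A, _, _, _⟩ ⟨B, _, _, _⟩ h
      cases h
      rfl
    exact h _ _ (Raw.alg_ofModel M)

end OmegaTheory

/-! ### Isomorphisms of categories -/

/-- A fully faithful functor which is bijective on objects is an isomorphism of categories. -/
theorem IsCatIso.of_bijective {C D : Type (u + 1)} [Category.{u} C] [Category.{u} D] (F : C ⥤ D)
    [F.Full] [F.Faithful] (hF : Function.Bijective F.obj) : IsCatIso F := by
  let e := Equiv.ofBijective F.obj hF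
  have he (Y : D) : F.obj (e.symm Y) = Y := e.apply_symm_apply Y
  let G : D ⥤ C :=
    { obj := e.symm
      -- `F.obj (e.symm Y)` and `Y` are equal only propositionally, hence the transports around `f`.
      map f := F.preimage (eqToHom (he _) ≫ f ≫ eqToHom (he _).symm)
      map_id Y := F.map_injective (by simp)
      map_comp f g := F.map_injective (by simp) }
  refine ⟨G, ?_, ?_⟩
  · refine CategoryTheory.Functor.ext (fun X => e.symm_apply_apply X) fun X Y f => F.map_injective ?_
    suffices F.map (G.map (F.map f)) = F.map (eqToHom (e.symm_apply_apply X) ≫ f ≫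
        eqToHom (e.symm_apply_apply Y).symm) from this
    rw [F.map_comp, F.map_comp, eqToHom_map, eqToHom_map]
    exact F.map_preimage _
  · exact CategoryTheory.Functor.ext he fun X Y f => by simp [G]

/-! ### Equality of omega magmas and of weak omega categories -/

/-- Two omega magmas with the same cells are equal if the identity maps are morphisms in both
directions. -/
theorem OmegaMagma.eq_of_hom {X Y : OmegaMagma.{u}} (φ : X ⟶ Y) (ψ : Y ⟶ X)
    (hc : X.cell = Y.cell) (hφ : ∀ i x, HEq (φ.app i x) x) (hψ : ∀ i x, HEq (ψ.app i x) x) :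
    X = Y := by
  obtain ⟨⟨⟨cell, dom, cod, _, _⟩, idn, _, _⟩, comp, _, _, _, _, _⟩ := X
  obtain ⟨⟨⟨cell', dom', cod', _, _⟩, idn', _, _⟩, comp', _, _, _, _, _⟩ := Y
  dsimp only at hc
  subst hc
  obtain ⟨⟨φ, φdom, φcod, φidn⟩, φcomp⟩ := φ
  obtain ⟨⟨ψ, ψdom, ψcod, ψidn⟩, ψcomp⟩ := ψ
  obtain rfl : φ = fun _ x => x := funext fun i => funext fun x => eq_of_heq (hφ i x)
  obtain rfl : ψ = fun _ x => x := funext fun i => funext fun x => eq_of_heq (hψ i x)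
  obtain rfl : dom = dom' := funext fun i => funext fun x => φdom i x
  obtain rfl : cod = cod' := funext fun i => funext fun x => φcod i x
  obtain rfl : idn = idn' := funext fun i => funext fun x => φidn i x
  -- A morphism gives just an inclusion of composition relations; `ψ` gives the reverse one.
  obtain rfl : comp = comp' := by
    funext i j h a b c
    exact propext ⟨φcomp i j h a b c, ψcomp i j h a b c⟩
  rfl

/-- An endomorphism of an omega magma whose components are identity maps is the identity. -/
theorem OmegaMagma.hom_eq_id {X : OmegaMagma.{u}} (φ : X ⟶ X) (hφ : ∀ i x, HEq (φ.app i x) x) :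
    φ = 𝟙 X :=
  OmegaMagma.Hom.ext (funext fun i => funext fun x => eq_of_heq (hφ i x))

/-- Two weak omega categories with the same cells are equal if the identity maps are omega functors
in both directions. -/
theorem WeakOmegaCat.eq_of_hom {X Y : WeakOmegaCat.{u}} (φ : X ⟶ Y) (ψ : Y ⟶ X)
    (hc₁ : X.X₁.cell = Y.X₁.cell) (hc₂ : X.X₂.cell = Y.X₂.cell) (hc₃ : X.X₃.cell = Y.X₃.cell)
    (hφ₁ : ∀ i x, HEq (φ.F₁.app i x) x) (hφ₂ : ∀ i x, HEq (φ.F₂.app i x) x)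
    (hφ₃ : ∀ i x, HEq (φ.F₃.app i x) x) (hψ₁ : ∀ i x, HEq (ψ.F₁.app i x) x)
    (hψ₂ : ∀ i x, HEq (ψ.F₂.app i x) x) (hψ₃ : ∀ i x, HEq (ψ.F₃.app i x) x) : X = Y := by
  obtain ⟨X₁, X₂, lam, rho, _, R, X₃, _, kappa, _⟩ := X
  obtain ⟨Y₁, Y₂, lam', rho', _, R', Y₃, _, kappa', _⟩ := Y
  obtain ⟨φ₁, φ₂, φ₃, hφR, hlam, hkappa, hrho⟩ := φ
  obtain ⟨ψ₁, ψ₂, ψ₃, hψR, _, _, _⟩ := ψ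
  dsimp only at *
  obtain rfl := OmegaMagma.eq_of_hom φ₁ ψ₁ hc₁ hφ₁ hψ₁
  obtain rfl := OmegaMagma.eq_of_hom φ₂ ψ₂ hc₂ hφ₂ hψ₂
  obtain rfl := OmegaMagma.eq_of_hom φ₃ ψ₃ hc₃ hφ₃ hψ₃
  obtain rfl := OmegaMagma.hom_eq_id φ₁ hφ₁
  obtain rfl := OmegaMagma.hom_eq_id φ₂ hφ₂
  obtain rfl := OmegaMagma.hom_eq_id φ₃ hφ₃
  obtain rfl := OmegaMagma.hom_eq_id ψ₂ hψ₂
  obtain rfl : lam = lam' := hlam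
  obtain rfl : kappa = kappa' := hkappa
  obtain rfl : rho = rho' := hrho
  -- Bridge relations are likewise only included in one another, so both functors are used.
  obtain rfl : R = R' := by
    cases R
    cases R'
    congr
    funext i a b c
    exact propext ⟨hφR i a b c, hψR i a b c⟩
  rfl

/-! ### The isomorphism between weak omega categories and models -/

namespace OmegaTheory

/-- The family of the three magmas of a weak omega category. -/
def family (X₁ X₂ X₃ : OmegaMagma.{u}) : Fin 3 → OmegaMagma.{u}
  | 0 => X₁
  | 1 => X₂
  | 2 => X₃

/-- A weak omega category, with its magmas in a family. -/
def toData (W : WeakOmegaCat.{u}) : Data.{u} where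
  magma := family W.X₁ W.X₂ W.X₃
  lam := W.lam
  rho := W.rho
  split := W.split
  R := W.R
  isStrict := W.isStrict
  kappa := W.kappa
  isPenon := W.isPenon

theorem toData_surjective (D : Data.{u}) : ∃ W, toData W = D := by
  obtain ⟨magma, lam, rho, split, R, isStrict, kappa, isPenon⟩ := D
  -- A function on `Fin 3` is only propositionally `family` of its values; after substitution all
  -- dependent fields match by definition.
  obtain ⟨X₁, X₂, X₃, rfl⟩ : ∃ X₁ X₂ X₃, magma = family X₁ X₂ X₃ :=
    ⟨magma 0, magma 1, magma 2, funext fun m => by fin_cases m <;> rfl⟩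
  exact ⟨⟨X₁, X₂, lam, rho, split, R, X₃, isStrict, kappa, isPenon⟩, rfl⟩

/-- The components of an omega functor, as a family. -/
def homFamily {X Y : WeakOmegaCat.{u}} (φ : X ⟶ Y) :
    ∀ m : Fin 3, (toData X).magma m ⟶ (toData Y).magma m
  | 0 => φ.F₁
  | 1 => φ.F₂
  | 2 => φ.F₃

theorem app_lam {X Y : WeakOmegaCat.{u}} (φ : X ⟶ Y) (n : ℕ) (x : X.X₂.cell n) :
    φ.F₁.app n (X.lam.app n x) = Y.lam.app n (φ.F₂.app n x) :=
  congrArg (fun f : X.X₂ ⟶ Y.X₁ => f.app n x) φ.lam_comm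

theorem app_kappa {X Y : WeakOmegaCat.{u}} (φ : X ⟶ Y) (n : ℕ) (x : X.X₂.cell n) :
    φ.F₃.app n (X.kappa.app n x) = Y.kappa.app n (φ.F₂.app n x) :=
  congrArg (fun f : X.X₂ ⟶ Y.X₃ => f.app n x) φ.kappa_comm

theorem app_rho {X Y : WeakOmegaCat.{u}} (φ : X ⟶ Y) (n : ℕ) (x : X.X₁.cell n) :
    φ.F₂.app n (X.rho.app n x) = Y.rho.app n (φ.F₁.app n x) :=
  congrArg (fun f : X.X₁.toOmegaGraph ⟶ Y.X₂.toOmegaGraph => OmegaGraph.Hom.app f n x) φ.rho_comm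

/-- The functor from weak omega categories to models of their theory. -/
noncomputable def toModel : OmegaCat.{u} ⥤ EssAlgTheory.Model.{u} theory where
  obj W := (toData W).model
  map {X Y} φ := EssAlgTheory.Model.Hom.mk (M := (toData X).model) (N := (toData Y).model)
    (fun s x => (homFamily φ s.1).app s.2 x) (fun f x a h => by
      refine (toData Y).mem_op_model.2 ?_
      replace h := (toData X).mem_op_model.1 h
      cases f with
      | dom m n => exact ((homFamily φ m).app_dom n _).symm.trans (congrArg _ h)
      | cod m n => exact ((homFamily φ m).app_cod n _).symm.trans (congrArg _ h)
      | idn m n => exact ((homFamily φ m).app_idn n _).symm.trans (congrArg _ h)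
      | lam n => exact (app_lam φ n _).symm.trans (congrArg _ h)
      | rho n => exact (app_rho φ n _).symm.trans (congrArg _ h)
      | kappa n => exact (app_kappa φ n _).symm.trans (congrArg _ h)
      | comp m i j hij => exact (homFamily φ m).app_comp i j hij _ _ _ h
      | bridge n => exact φ.isBridgeMorphism n _ _ _ h)
  map_id X := EssAlgTheory.Model.hom_ext fun s x => by
    obtain ⟨m, n⟩ := s
    fin_cases m <;> rfl
  map_comp φ ψ := EssAlgTheory.Model.hom_ext fun s x => by
    obtain ⟨m, n⟩ := s
    fin_cases m <;> rfl

theorem map_graph {X Y : WeakOmegaCat.{u}} (φ : toModel.obj X ⟶ toModel.obj Y) (f : OpSym)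
    (x : Fin f.arity → (toData X).raw.carrier f.src) (a : (toData X).raw.carrier f.tgt)
    (h : (toData X).raw.graph f x a) :
    (toData Y).raw.graph f (fun k => EssAlgTheory.Model.Hom.app φ f.src (x k))
      (EssAlgTheory.Model.Hom.app φ f.tgt a) :=
  (toData Y).mem_op_model.1 (EssAlgTheory.Model.Hom.app_op φ f x a
    ((toData X).mem_op_model.2 h))

/-- The morphisms of magmas underlying a morphism of models. -/
def magmaHom {X Y : WeakOmegaCat.{u}} (φ : toModel.obj X ⟶ toModel.obj Y) (m : Fin 3) :
    (toData X).magma m ⟶ (toData Y).magma m :=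
  OmegaMagma.Hom.mk (X := (toData X).magma m) (Y := (toData Y).magma m)
    { app := fun n => EssAlgTheory.Model.Hom.app φ (m, n)
      app_dom := fun n x => (map_graph φ (.dom m n) (fun _ => x) _ rfl).symm
      app_cod := fun n x => (map_graph φ (.cod m n) (fun _ => x) _ rfl).symm
      app_idn := fun n x => (map_graph φ (.idn m n) (fun _ => x) _ rfl).symm }
    (fun i j h a b c hc => map_graph φ (.comp m i j h) ![a, b] c hc)

/-- Each clause in the definition of an omega functor is the preservation of one kind of operation
symbol. -/
instance : toModel.{u}.Full where
  map_surjective {X Y} φ := by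
    refine ⟨WeakOmegaCat.Hom.mk (X := X) (Y := Y) (magmaHom φ 0) (magmaHom φ 1) (magmaHom φ 2)
      (fun n a b c h => map_graph φ (.bridge n) ![a, b] c h) ?_ ?_ ?_, ?_⟩
    · exact OmegaMagma.Hom.ext (funext fun n => funext fun x =>
        (map_graph φ (.lam n) (fun _ => x) _ rfl).symm)
    · exact OmegaMagma.Hom.ext (funext fun n => funext fun x =>
        (map_graph φ (.kappa n) (fun _ => x) _ rfl).symm)
    · exact OmegaGraph.Hom.ext (funext fun n => funext fun x =>
        (map_graph φ (.rho n) (fun _ => x) _ rfl).symm)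
    · refine EssAlgTheory.Model.hom_ext fun s x => ?_
      obtain ⟨m, n⟩ := s
      fin_cases m <;> rfl

theorem toModel_map_app {X Y : WeakOmegaCat.{u}} (φ : X ⟶ Y) (m : Fin 3) (n : ℕ)
    (x : (toData X).raw.cell m n) :
    EssAlgTheory.Model.Hom.app (toModel.map φ) (m, n) x = (homFamily φ m).app n x := rfl

instance : toModel.{u}.Faithful where
  map_injective {X Y} φ ψ h := by
    have key (m : Fin 3) : homFamily φ m = homFamily ψ m :=
      OmegaMagma.Hom.ext (funext fun n => funext fun x =>
        congrArg (fun f : toModel.obj X ⟶ toModel.obj Y => EssAlgTheory.Model.Hom.app f (m, n) x) h)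
    exact WeakOmegaCat.Hom.ext (key 0) (key 1) (key 2)

theorem eqToHom_app_heq {M N : EssAlgTheory.Model.{u} theory} (h : M = N) (s : theory.Sorts)
    (x : M.carrier s) : HEq (EssAlgTheory.Model.Hom.app (eqToHom h) s x) x := by
  subst h
  rfl

/-- By fullness, the transports along an equality of models lift to omega functors in both
directions. Transport does not move elements, so these are identities on cells and
`WeakOmegaCat.eq_of_hom` applies. -/
theorem toModel_obj_injective : Function.Injective toModel.{u}.obj := by
  intro X Y h
  have hφ (m : Fin 3) (n : ℕ) (x : (toData X).raw.cell m n) :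
      HEq ((homFamily (toModel.preimage (eqToHom h)) m).app n x) x := by
    rw [← toModel_map_app, toModel.map_preimage]
    exact eqToHom_app_heq h (m, n) x
  have hψ (m : Fin 3) (n : ℕ) (x : (toData Y).raw.cell m n) :
      HEq ((homFamily (toModel.preimage (eqToHom h.symm)) m).app n x) x := by
    rw [← toModel_map_app, toModel.map_preimage]
    exact eqToHom_app_heq h.symm (m, n) x
  have hc (m : Fin 3) : (toData X).raw.cell m = (toData Y).raw.cell m :=
    funext fun n => congrArg (fun M : EssAlgTheory.Model.{u} theory => M.carrier (m, n)) h
  exact WeakOmegaCat.eq_of_hom (toModel.preimage (eqToHom h)) (toModel.preimage (eqToHom h.symm))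
    (hc 0) (hc 1) (hc 2) (hφ 0) (hφ 1) (hφ 2) (hψ 0) (hψ 1) (hψ 2)

theorem isCatIso_toModel : IsCatIso toModel.{u} :=
  IsCatIso.of_bijective _ ⟨toModel_obj_injective, fun M => by
    obtain ⟨D, rfl⟩ := Data.exists_model_eq M
    obtain ⟨W, rfl⟩ := toData_surjective D
    exact ⟨W, rfl⟩⟩

/-- The equivalence between weak omega categories and models of their theory. -/
noncomputable def equivalence : OmegaCat.{u} ≌ EssAlgTheory.Model.{u} theory :=
  have : toModel.{u}.EssSurj := ⟨fun M =>
    let ⟨W, hW⟩ : ∃ W, toModel.obj W = M := by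
      obtain ⟨D, rfl⟩ := Data.exists_model_eq M
      obtain ⟨W, rfl⟩ := toData_surjective D
      exact ⟨W, rfl⟩
    ⟨W, ⟨eqToIso hW⟩⟩⟩
  have : toModel.{u}.IsEquivalence := {}
  toModel.asEquivalence

end OmegaTheory

/-- The category of weak omega categories is (isomorphic to) the category of models of a finitary
essentially algebraic theory; it is locally finitely presentable, complete and cocomplete. -/
theorem theorem16 :
    (∃ (T : EssAlgTheory) (F : OmegaCat.{u} ⥤ EssAlgTheory.Model.{u} T), IsCatIso F) ∧
      IsLocallyFinitelyPresentable.{u} OmegaCat.{u} ∧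
      Limits.HasLimits OmegaCat.{u} ∧ Limits.HasColimits OmegaCat.{u} := by
  have := Cardinal.fact_isRegular_aleph0.{u}
  exact ⟨⟨OmegaTheory.theory, OmegaTheory.toModel, OmegaTheory.isCatIso_toModel⟩,
    OmegaTheory.equivalence.symm.isCardinalLocallyPresentable _,
    Adjunction.has_limits_of_equivalence OmegaTheory.equivalence.functor,
    Adjunction.has_colimits_of_equivalence OmegaTheory.equivalence.functor⟩
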